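/- Let $B$ be a $2\times n$ board whose squares are coloured by $\omega$ with colours from a finite set $C$. Let $G$ be its graph: the vertices are the squares, and two squares are adjacent when they are horizontally or vertically adjacent. In a vertex-coloured graph, a move $(v,d)$ gives colour $d\in C$ to every vertex of the monochromatic component of $v$. A set of vertices is linked if it lies in a single monochromatic component. A border is a path of edges of squares from the top to the bottom of the board that uses no edge of the top or bottom side; it is determined by the points at which it meets the top and the bottom. A square is incident with a border $b$ if one of its edges is part of $b$. Write $b_1\le b_2$ if $b_1$ meets both the top and the bottom to the left of, or at the same point as, $b_2$, and $b_1<b_2$ if also $b_1\ne b_2$. For $b_1<b_2$ let $B[b_1,b_2]$ be the subgraph of $G$ induced by the squares between $b_1$ and $b_2$; it is a section if it is connected. For a tree $T$, let $\mathrm{bare}(T)$ be $T$ with all its leaves deleted, and let $P(T,x,y)$ be the path from $x$ to $y$ in $T$. Let $Z(B)$ be the set of vectors $\mathbf z=(b_1,b_2,r_1,r_2,d,I)$ such that $B[b_1,b_2]$ is a section; $r_1,r_2$ are vertices of it, incident with $b_1$ and $b_2$ respectively; there is a spanning tree $T$ of $B[b_1,b_2]$ with $\mathrm{bare}(T)\subseteq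 P(T,r_1,r_2)$; $d\in C$; and $I\subseteq C$. For $\mathbf z\in Z(B)$ let $f(\mathbf z)$ be the minimum length of a sequence of moves $S$, taken over all spanning trees $T$ of $B[b_1,b_2]$ with $\mathrm{bare}(T)\subseteq P(T,r_1,r_2)$ and all $S$ such that every move of $S$ is played at a vertex of $P(T,r_1,r_2)$, and playing $S$ in $T$ (starting from $\omega$) gives colour $d$ to all of $P(T,r_1,r_2)$ and links to $P(T,r_1,r_2)$ every leaf of $T$ whose initial colour is not in $I$. Let $f^*$ be the function with values in $\{0,1,2,\dots\}\cup\{\infty\}$ computed as follows. Initially $f^*(\mathbf z)=0$ if, under $\omega$, there is an $r_1$–$r_2$ path of colour $d$ in $B[b_1,b_2]$ such that all vertices of $B[b_1,b_2]$ not on the path are adjacent to the path and have colours from $I\cup\{d\}$; otherwise $f^*(\mathbf z)=\infty$ initially. The entries that are not initialised to zero are then determined by applying repeatedly the recursion $f^*(\mathbf z)=\min\{f_1(\mathbf z),f_2(\mathbf z)\}$, where $$f_1(\mathbf z)=1+\min_{d'\in C} f^*(b_1,b_2,r_1,r_2,d',I\cup\{d\}),$$ $$f_2(\mathbf z)=\min\{f^*(b_1,b,r_1,x_1,d,I)+f^*(b,b_2,x_2,r_2,d,I)\},$$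 the last minimum being over all borders $b$ with $b_1<b<b_2$ and all edges $x_1x_2$ of $G$ such that $(b_1,b,r_1,x_1,d,I)$ and $(b,b_2,x_2,r_2,d,I)$ both lie in $Z(B)$ (with $\min\emptyset=\infty$). Then, for every $\mathbf z\in Z(B)$, the minimum defining $f(\mathbf z)$ exists, and $f^*(\mathbf z)=f(\mathbf z)$. -/

import Mathlib

namespace FloodIt

/-! ### The game on a coloured graph -/

section Game

variable {V C : Type*}

/-- The edges of `H` both of whose ends have the same colour under `ω`; the monochromatic
components are the connected components of this graph. -/
def monoGraph (H : SimpleGraph V) (ω : V → C) : SimpleGraph V where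
  Adj u v := H.Adj u v ∧ ω u = ω v
  symm := ⟨fun _ _ h => ⟨h.1.symm, h.2.symm⟩⟩
  loopless := ⟨fun _ h => H.loopless.irrefl _ h.1⟩

/-- `u` and `v` lie in the same monochromatic component of `H` under `ω`. -/
def SameComponent (H : SimpleGraph V) (ω : V → C) (u v : V) : Prop :=
  (monoGraph H ω).Reachable u v

open Classical in
/-- The colouring after the move `m = (v, d)`, which gives colour `d` to the whole monochromatic
component of `v`. -/
noncomputable def playMove (H : SimpleGraph V) (ω : V → C) (m : V × C) : V → C :=
  fun w => if SameComponent H ω m.1 w then m.2 else ω w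

/-- The colouring obtained by playing the sequence `S` in `H`, starting from `ω`. -/
noncomputable def play (H : SimpleGraph V) (ω : V → C) (S : List (V × C)) : V → C :=
  S.foldl (playMove H) ω

/-- A set of vertices is linked if it is contained in a single monochromatic component. -/
def Linked (H : SimpleGraph V) (ω : V → C) (A : Set V) : Prop :=
  ∀ u ∈ A, ∀ v ∈ A, SameComponent H ω u v

end Game

/-! ### Boards, borders and sections -/

/-- The squares of a `2 × n` board, as pairs (row, column). -/
abbrev Square (n : ℕ) : Type := Fin 2 × Fin n

/-- The graph of the `2 × n` board: squares are adjacent when they are horizontally or vertically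
adjacent. -/
def boardGraph (n : ℕ) : SimpleGraph (Square n) :=
  SimpleGraph.boxProd (SimpleGraph.pathGraph 2) (SimpleGraph.pathGraph n)

/-- A border is determined by the points at which it meets the top and the bottom of the board.
`b i` is the number of squares of row `i` that lie to the left of `b`. The pointwise order is the
left-to-right order of borders. -/
abbrev Border (n : ℕ) : Type := Fin 2 → Fin (n + 1)

/-- The square `v` has an edge that forms part of `b`. The border `b` consists of the left or right
edge of a square in each row, at positions `b 0` and `b 1`, and of the part of the line between the
two rows that joins these positions. -/
def Incident {n : ℕ} (v : Square n) (b : Border n) : Prop :=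
  (v.2 : ℕ) = b v.1 ∨ (v.2 : ℕ) + 1 = b v.1 ∨
    (min (b 0 : ℕ) (b 1) ≤ v.2 ∧ (v.2 : ℕ) < max (b 0 : ℕ) (b 1))

/-- The squares lying between the borders `b₁` and `b₂`. -/
def between {n : ℕ} (b₁ b₂ : Border n) : Set (Square n) :=
  {v | (b₁ v.1 : ℕ) ≤ v.2 ∧ (v.2 : ℕ) < b₂ v.1}

/-- `B[b₁, b₂]` is a section: `b₁ < b₂`, and the induced subgraph is connected. -/
def IsSection {n : ℕ} (b₁ b₂ : Border n) : Prop :=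
  b₁ < b₂ ∧ ((boardGraph n).induce (between b₁ b₂)).Connected

/-! ### Spanning trees -/

/-- The set of all spanning trees of `B[b₁, b₂]`. -/
def spanningTrees {n : ℕ} (b₁ b₂ : Border n) : Set (boardGraph n).Subgraph :=
  {T | T.verts = between b₁ b₂ ∧ T.coe.IsTree}

/-- The leaves of `T`, that is, its vertices of degree one. -/
def leaves {n : ℕ} (T : (boardGraph n).Subgraph) : Set (Square n) :=
  {v | ∃! w, T.Adj v w}

/-- The vertices of the subtree obtained from `T` by deleting all leaves. -/
def bare {n : ℕ} (T : (boardGraph n).Subgraph) : Set (Square n) :=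
  T.verts \ leaves T

/-- The vertices of the path from `x` to `y` in a tree `T`. -/
def treePath {n : ℕ} (T : (boardGraph n).Subgraph) (x y : Square n) : Set (Square n) :=
  {v | ∃ p : T.spanningCoe.Walk x y, p.IsPath ∧ v ∈ p.support}

/-! ### Parameter vectors -/

/-- A vector `(b₁, b₂, r₁, r₂, d, I)`. -/
structure Param (n : ℕ) (C : Type*) where
  b₁ : Border n
  b₂ : Border n
  r₁ : Square n
  r₂ : Square n
  d : C
  I : Set C

/-- The set `Z(B)` of admissible vectors. -/
def Z (n : ℕ) (C : Type*) : Set (Param n C) :=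
  {z | IsSection z.b₁ z.b₂ ∧ z.r₁ ∈ between z.b₁ z.b₂ ∧ z.r₂ ∈ between z.b₁ z.b₂ ∧
    (∃ T ∈ spanningTrees z.b₁ z.b₂, bare T ⊆ treePath T z.r₁ z.r₂) ∧
    Incident z.r₁ z.b₁ ∧ Incident z.r₂ z.b₂}

variable {n : ℕ} {C : Type*}

/-! ### The function `f` -/

/-- All moves of `S` are played in `P(T, r₁, r₂)`, and playing `S` in `T` floods `P(T, r₁, r₂)` with
colour `d` and links to it all leaves of `T` that do not have (initial) colours from `I`. -/
def Achieves (ω : Square n → C) (z : Param n C) (T : (boardGraph n).Subgraph)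
    (S : List (Square n × C)) : Prop :=
  (∀ m ∈ S, m.1 ∈ treePath T z.r₁ z.r₂) ∧
  (∀ v ∈ treePath T z.r₁ z.r₂, play T.spanningCoe ω S v = z.d) ∧
  (∀ v ∈ leaves T, ω v ∉ z.I →
    Linked T.spanningCoe (play T.spanningCoe ω S) (insert v (treePath T z.r₁ z.r₂)))

/-- `f(z)`: the least length of a sequence as above, over all spanning trees `T` of `B[b₁, b₂]`
whose non-leaf vertices lie on `P(T, r₁, r₂)`. -/
noncomputable def f (ω : Square n → C) (z : Param n C) : ℕ∞ :=
  sInf {m : ℕ∞ | ∃ T ∈ spanningTrees z.b₁ z.b₂, bare T ⊆ treePath T z.r₁ z.r₂ ∧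
    ∃ S : List (Square n × C), Achieves ω z T S ∧ m = S.length}

/-! ### The dynamic program -/

/-- The condition under which the table entry at `z` is initialised to zero: there is an
`r₁`-`r₂` path of colour `d` in `B[b₁, b₂]`, and all vertices of `B[b₁, b₂]` not on this path are
adjacent to it and have colours from `I ∪ {d}`. -/
def InitZero (ω : Square n → C) (z : Param n C) : Prop :=
  ∃ p : (boardGraph n).Walk z.r₁ z.r₂, p.IsPath ∧
    (∀ v ∈ p.support, v ∈ between z.b₁ z.b₂ ∧ ω v = z.d) ∧
    ∀ v ∈ between z.b₁ z.b₂, v ∉ p.support →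
      (∃ u ∈ p.support, (boardGraph n).Adj v u) ∧ ω v ∈ z.I ∪ {z.d}

/-- `f₁(z) = 1 + min_{d'} F(b₁, b₂, r₁, r₂, d', I ∪ {d})`, computed from the table `F`. -/
noncomputable def f₁ (F : Param n C → ℕ∞) (z : Param n C) : ℕ∞ :=
  1 + ⨅ d' : C, F ⟨z.b₁, z.b₂, z.r₁, z.r₂, d', z.I ∪ {z.d}⟩

/-- The conditions under which the border `b` and the edge `x₁x₂` may be used to split `z`. -/
def IsSplit (z : Param n C) (b : Border n) (x₁ x₂ : Square n) : Prop :=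
  (⟨z.b₁, b, z.r₁, x₁, z.d, z.I⟩ : Param n C) ∈ Z n C ∧
  (⟨b, z.b₂, x₂, z.r₂, z.d, z.I⟩ : Param n C) ∈ Z n C ∧
  z.b₁ < b ∧ b < z.b₂ ∧ (boardGraph n).Adj x₁ x₂

/-- `f₂(z)`, the minimum over all splits of `z` of `F(b₁, b, r₁, x₁, d, I) + F(b, b₂, x₂, r₂, d, I)`,
computed from the table `F` (and infinite if there is no split). -/
noncomputable def f₂ (F : Param n C → ℕ∞) (z : Param n C) : ℕ∞ :=
  ⨅ (b : Border n) (x₁ : Square n) (x₂ : Square n) (_ : IsSplit z b x₁ x₂),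
    (F ⟨z.b₁, b, z.r₁, x₁, z.d, z.I⟩ + F ⟨b, z.b₂, x₂, z.r₂, z.d, z.I⟩)

open Classical in
/-- One application of the recursion to every entry of the table `F`: entries that are initialised
to zero stay zero, all others become `min {f₁, f₂}`. -/
noncomputable def step (ω : Square n → C) (F : Param n C → ℕ∞) : Param n C → ℕ∞ :=
  fun z => if InitZero ω z then 0 else min (f₁ F z) (f₂ F z)

open Classical in
/-- The table after `k` applications of the recursion; initially its entries are zero or infinity. -/
noncomputable def table (ω : Square n → C) : ℕ → Param n C → ℕ∞
  | 0 => fun z => if InitZero ω z then 0 else ⊤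
  | k + 1 => step ω (table ω k)

/-- `f*(z)`: the final value of the table entry at `z`. The entries decrease with `k`, so this is
their eventual value; see `fStar_eq_step` and `eq_fStar_of_eq_step`. -/
noncomputable def fStar (ω : Square n → C) (z : Param n C) : ℕ∞ :=
  ⨅ k, table ω k z

theorem f₂_le (F : Param n C → ℕ∞) {z : Param n C} {b : Border n} {x₁ x₂ : Square n}
    (hs : IsSplit z b x₁ x₂) :
    f₂ F z ≤ F ⟨z.b₁, b, z.r₁, x₁, z.d, z.I⟩ + F ⟨b, z.b₂, x₂, z.r₂, z.d, z.I⟩ := by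
  unfold f₂
  exact iInf_le_of_le b (iInf_le_of_le x₁ (iInf_le_of_le x₂ (iInf_le_of_le hs le_rfl)))

theorem step_mono (ω : Square n → C) {F G : Param n C → ℕ∞} (h : ∀ z, F z ≤ G z)
    (z : Param n C) : step ω F z ≤ step ω G z := by
  unfold step f₁ f₂
  split_ifs
  · exact le_rfl
  · refine min_le_min (add_le_add le_rfl (iInf_mono fun _ => h _)) ?_
    exact iInf_mono fun _ => iInf_mono fun _ => iInf_mono fun _ => iInf_mono fun _ =>
      add_le_add (h _) (h _)

theorem table_succ_le (ω : Square n → C) (k : ℕ) : ∀ z, table ω (k + 1) z ≤ table ω k z := by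
  induction k with
  | zero =>
    intro z
    by_cases h : InitZero ω z <;> simp [table, step, h]
  | succ k ih => exact step_mono ω ih

theorem table_antitone (ω : Square n → C) (z : Param n C) : Antitone fun k => table ω k z :=
  antitone_nat_of_succ_le fun k => table_succ_le ω k z

theorem exists_table_eq (ω : Square n → C) (z : Param n C) : ∃ k, table ω k z = fStar ω z :=
  ciInf_mem fun k => table ω k z

/-- `f*` satisfies the recursion. -/
theorem fStar_eq_step (ω : Square n → C) (z : Param n C) :
    fStar ω z = step ω (fStar ω) z := by
  apply le_antisymm
  · have key : ∀ k, fStar ω z ≤ step ω (table ω k) z := fun k => iInf_le _ (k + 1)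
    by_cases h0 : InitZero ω z
    · simpa [step, h0] using key 0
    · simp only [step, h0, if_false, f₁, le_min_iff] at key ⊢
      refine ⟨?_, ?_⟩
      · have : Nonempty C := ⟨z.d⟩
        obtain ⟨d', hd'⟩ := ciInf_mem fun d' : C =>
          fStar ω ⟨z.b₁, z.b₂, z.r₁, z.r₂, d', z.I ∪ {z.d}⟩
        obtain ⟨k, hk⟩ := exists_table_eq ω ⟨z.b₁, z.b₂, z.r₁, z.r₂, d', z.I ∪ {z.d}⟩
        refine (key k).1.trans (add_le_add le_rfl ?_)
        rw [← hd']
        exact (iInf_le _ d').trans hk.le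
      · unfold f₂
        refine le_iInf fun b => le_iInf fun x₁ => le_iInf fun x₂ => le_iInf fun hs => ?_
        obtain ⟨k, hk⟩ := exists_table_eq ω ⟨z.b₁, b, z.r₁, x₁, z.d, z.I⟩
        obtain ⟨l, hl⟩ := exists_table_eq ω ⟨b, z.b₂, x₂, z.r₂, z.d, z.I⟩
        refine (key (max k l)).2.trans ?_
        refine (f₂_le _ hs).trans ?_
        rw [← hk, ← hl]
        exact add_le_add (table_antitone ω _ (le_max_left _ _))
          (table_antitone ω _ (le_max_right _ _))
  · refine le_iInf fun k => ?_
    refine le_trans ?_ (table_succ_le ω k z)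
    exact step_mono ω (fun z => iInf_le _ k) z

/-- The position of a border, used to measure sections. -/
def Border.size (b : Border n) : ℕ := (b 0 : ℕ) + b 1

theorem Border.size_lt {b b' : Border n} (h : b < b') : b.size < b'.size := by
  obtain ⟨hle, i, hi⟩ := Pi.lt_def.1 h
  have h0 : (b 0 : ℕ) ≤ b' 0 := hle 0
  have h1 : (b 1 : ℕ) ≤ b' 1 := hle 1
  have hi' : (b i : ℕ) < b' i := hi
  unfold Border.size
  fin_cases i <;> simp at hi' <;> omega

theorem le_of_eq_step (ω : Square n → C) {F G : Param n C → ℕ∞}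
    (hF : ∀ z, F z = step ω F z) (hG : ∀ z, G z = step ω G z) (z : Param n C) : F z ≤ G z := by
  suffices H : ∀ (N : ℕ) (g : ℕ) (z : Param n C), z.b₂.size - z.b₁.size = N → G z = g →
      F z ≤ G z by
    by_cases ht : G z = ⊤
    · simp [ht]
    · obtain ⟨g, hg⟩ := ENat.ne_top_iff_exists.1 ht
      exact H _ g z rfl hg.symm
  intro N
  induction N using Nat.strong_induction_on with
  | _ N ih =>
  have ih' : ∀ z : Param n C, z.b₂.size - z.b₁.size < N → F z ≤ G z := by
    intro z hz
    by_cases ht : G z = ⊤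
    · simp [ht]
    · obtain ⟨g, hg⟩ := ENat.ne_top_iff_exists.1 ht
      exact ih _ hz g z rfl hg.symm
  intro g
  induction g using Nat.strong_induction_on with
  | _ g ihg =>
  intro z hN hg
  rw [hF z]
  have hGz := hG z
  by_cases h0 : InitZero ω z
  · simp [step, h0]
  simp only [step, h0, if_false] at hGz ⊢
  rcases min_choice (f₁ G z) (f₂ G z) with hm | hm
  · rw [hm] at hGz
    refine (min_le_left _ _).trans ?_
    have : Nonempty C := ⟨z.d⟩
    obtain ⟨d', hd'⟩ := ciInf_mem fun d' : C => G ⟨z.b₁, z.b₂, z.r₁, z.r₂, d', z.I ∪ {z.d}⟩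
    rw [hGz, f₁, f₁, ← hd']
    refine add_le_add le_rfl ((iInf_le _ d').trans ?_)
    rw [f₁, ← hd', hg] at hGz
    have hne : G ⟨z.b₁, z.b₂, z.r₁, z.r₂, d', z.I ∪ {z.d}⟩ ≠ ⊤ := by
      intro ht
      dsimp only at hGz
      rw [ht] at hGz
      simp at hGz
    obtain ⟨g', hg'⟩ := ENat.ne_top_iff_exists.1 hne
    simp only [← hg'] at hGz
    have hgg : g = 1 + g' := by exact_mod_cast hGz
    exact ihg g' (by omega) _ hN hg'.symm
  · rw [hm] at hGz
    refine (min_le_right _ _).trans ?_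
    rw [hGz]
    conv_rhs => unfold f₂
    refine le_iInf fun b => le_iInf fun x₁ => le_iInf fun x₂ => le_iInf fun hs => ?_
    have hb₁ := Border.size_lt hs.2.2.1
    have hb₂ := Border.size_lt hs.2.2.2.1
    refine (f₂_le _ hs).trans ?_
    exact add_le_add (ih' _ (by dsimp only; omega)) (ih' _ (by dsimp only; omega))

/-- `f*` is the only solution of the recursion. -/
theorem eq_fStar_of_eq_step (ω : Square n → C) {F : Param n C → ℕ∞}
    (hF : ∀ z, F z = step ω F z) : F = fStar ω :=
  funext fun z => le_antisymm (le_of_eq_step ω hF (fStar_eq_step ω) z)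
    (le_of_eq_step ω (fStar_eq_step ω) hF z)

end FloodIt

/-! A tree whose non-leaf vertices lie on `P(T, r₁, r₂)` is a caterpillar, and playing at its path
vertices amounts to playing on a line of integers. An off-path leaf joins its anchor on the path as
soon as the anchor takes the leaf's initial colour, and follows it from then on. Once the path is
flooded, the leaf is therefore linked to it exactly when its initial colour occurs in the history of
its anchor, initial colouring included (`IsCatTree.play_eq`, `IsCatTree.achieves_iff`). So `f` is
the least length of a sequence satisfying `LineAchieves`, over all caterpillars spanning the
section.

The central notion is that of a crossed path edge: one whose two ends are recoloured by a common
move. Neighbours of equal colour stay equal forever, and an edge that is never crossed cuts the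
sequence into two independent ones.

For `f* ≤ f` (`fStar_le_length`), take a sequence for a caterpillar. If some edge is not crossed,
both the sequence and the caterpillar split there, the halves of the caterpillar are separated by a
border (`Caterpillar.exists_border`), and `f₂` applies. If all edges are crossed, the path is
already monochromatic before the last move, which can be dropped by `f₁`; with no moves at all, a
single path vertex remains and the entry is initialised to zero.

For `f ≤ f*`, the hard point is `f₂`: the moves for one half may spill into the other, yet `a + b`
moves must suffice for the union (`LineCost.append`). Cut both halves into blocks with all edges
crossed. A block is either an untouched cell of colour `d`, or ends with a move recolouring all of
it. Two blocks of the latter kind are merged by bringing the right one to the colour `d'` that the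
left one has before its last move, combining these shorter tasks by induction, and finishing with
one common move. An untouched cell to the right of such a block is either swallowed by it for free
or never reached by it, and then the two sides can be played in succession.

Finiteness of `C` makes `f` finite, since a cell can run through all colours. -/

namespace FloodIt

/-! ### The game on a line -/

section Line

variable {C : Type*}

/-- `i` and `j` lie in the same monochromatic interval of the line coloured by `c`. -/
def LineComp (c : ℕ → C) (i j : ℕ) : Prop := ∀ t ∈ Set.uIcc i j, c t = c i

open Classical in
/-- The colouring of the line after the move `m`. -/
noncomputable def lineMove (c : ℕ → C) (m : ℕ × C) : ℕ → C :=
  fun j => if LineComp c m.1 j then m.2 else c j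

/-- The colouring of the line after playing `S`. -/
noncomputable def linePlay (c : ℕ → C) (S : List (ℕ × C)) : ℕ → C := S.foldl lineMove c

/-- The colours taken by `i` while `S` is played on the line. -/
def lineHist (c : ℕ → C) (S : List (ℕ × C)) (i : ℕ) : Set C :=
  {x | ∃ S', S' <+: S ∧ linePlay c S' i = x}

@[simp] theorem linePlay_nil (c : ℕ → C) : linePlay c [] = c := rfl

theorem linePlay_append (c : ℕ → C) (S S' : List (ℕ × C)) :
    linePlay c (S ++ S') = linePlay (linePlay c S) S' := List.foldl_append

theorem linePlay_concat (c : ℕ → C) (S : List (ℕ × C)) (m : ℕ × C) :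
    linePlay c (S ++ [m]) = lineMove (linePlay c S) m := by
  rw [linePlay_append]; rfl

theorem lineHist_nil (c : ℕ → C) (i : ℕ) : lineHist c [] i = {c i} := by
  ext x
  simp [lineHist, eq_comm]

theorem lineHist_concat (c : ℕ → C) (S : List (ℕ × C)) (m : ℕ × C) (i : ℕ) :
    lineHist c (S ++ [m]) i = insert (linePlay c (S ++ [m]) i) (lineHist c S i) := by
  ext x
  simp only [lineHist, Set.mem_ofPred_eq, Set.mem_insert_iff, List.prefix_concat_iff]
  constructor
  · rintro ⟨S', rfl | h, rfl⟩
    · exact Or.inl rfl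
    · exact Or.inr ⟨S', h, rfl⟩
  · rintro (rfl | ⟨S', h, rfl⟩)
    · exact ⟨_, Or.inl rfl, rfl⟩
    · exact ⟨S', Or.inr h, rfl⟩

theorem linePlay_mem_lineHist (c : ℕ → C) (S : List (ℕ × C)) (i : ℕ) :
    linePlay c S i ∈ lineHist c S i := ⟨S, List.prefix_rfl, rfl⟩

theorem lineHist_append_left (c : ℕ → C) (S S' : List (ℕ × C)) (i : ℕ) :
    lineHist c S i ⊆ lineHist c (S ++ S') i := by
  rintro x ⟨S₀, h, rfl⟩
  exact ⟨S₀, h.trans (List.prefix_append _ _), rfl⟩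

theorem lineHist_append_right (c : ℕ → C) (S S' : List (ℕ × C)) (i : ℕ) :
    lineHist (linePlay c S) S' i ⊆ lineHist c (S ++ S') i := by
  rintro x ⟨S₀, h, rfl⟩
  exact ⟨S ++ S₀, (List.prefix_append_right_inj S).2 h, by rw [linePlay_append]⟩

theorem LineComp.mono {c : ℕ → C} {i j k : ℕ} (h : LineComp c i j) (hk : k ∈ Set.uIcc i j) :
    LineComp c i k :=
  fun t ht => h t (Set.uIcc_subset_uIcc Set.left_mem_uIcc hk ht)

/-! ### Locality of play on the line -/

theorem lineMove_congr {D : Set ℕ} [hD : D.OrdConnected] {c c' : ℕ → C} (h : Set.EqOn c c' D)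
    {m : ℕ × C} (hm : m.1 ∈ D) : Set.EqOn (lineMove c m) (lineMove c' m) D := by
  intro i hi
  have : LineComp c m.1 i ↔ LineComp c' m.1 i := by
    refine forall₂_congr fun t ht => ?_
    rw [h (hD.uIcc_subset hm hi ht), h hm]
  simp only [lineMove, h hi]
  classical exact if_congr this rfl rfl

/-- If moves played outside of `D` never affect `D`, then `D` does not notice them. -/
theorem linePlay_filter {D : Set ℕ} [D.OrdConnected] [DecidablePred (· ∈ D)] {c c' : ℕ → C}
    (hc : Set.EqOn c c' D)
    (S : List (ℕ × C))
    (hS : ∀ S' m, S' ++ [m] <+: S → m.1 ∉ D → ∀ i ∈ D, ¬ LineComp (linePlay c S') m.1 i) :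
    Set.EqOn (linePlay c S) (linePlay c' (S.filter (·.1 ∈ D))) D ∧
      ∀ i ∈ D, lineHist c S i = lineHist c' (S.filter (·.1 ∈ D)) i := by
  induction S using List.reverseRecOn with
  | nil => exact ⟨hc, fun i hi => by simp [lineHist_nil, hc hi]⟩
  | append_singleton S m ih =>
    obtain ⟨ih₁, ih₂⟩ := ih fun S' m' h => hS S' m' (h.trans (List.prefix_append _ _))
    by_cases hm : m.1 ∈ D
    · have e : (S ++ [m]).filter (fun a => decide (a.1 ∈ D)) = S.filter (·.1 ∈ D) ++ [m] := by
        simp [hm]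
      have key : Set.EqOn (linePlay c (S ++ [m])) (linePlay c' (S.filter (·.1 ∈ D) ++ [m])) D := by
        rw [linePlay_concat, linePlay_concat]
        exact lineMove_congr ih₁ hm
      rw [e]
      refine ⟨key, fun i hi => ?_⟩
      rw [lineHist_concat, lineHist_concat, key hi, ih₂ i hi]
    · have e : (S ++ [m]).filter (fun a => decide (a.1 ∈ D)) = S.filter (·.1 ∈ D) := by simp [hm]
      have key : Set.EqOn (linePlay c (S ++ [m])) (linePlay c S) D := by
        intro i hi
        rw [linePlay_concat]
        simp [lineMove, hS S m List.prefix_rfl hm i hi]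
      rw [e]
      refine ⟨key.trans ih₁, fun i hi => ?_⟩
      rw [lineHist_concat, key hi, ← ih₂ i hi]
      exact Set.insert_eq_of_mem (linePlay_mem_lineHist _ _ _)

theorem linePlay_congr {D : Set ℕ} [D.OrdConnected] {c c' : ℕ → C} (hc : Set.EqOn c c' D)
    (S : List (ℕ × C)) (hS : ∀ m ∈ S, m.1 ∈ D) :
    Set.EqOn (linePlay c S) (linePlay c' S) D ∧
      ∀ i ∈ D, lineHist c S i = lineHist c' S i := by
  classical
  have e : S.filter (fun a => decide (a.1 ∈ D)) = S := by simpa using fun a b h => hS (a, b) h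
  have := linePlay_filter hc S fun S' m h hm => absurd (hS m (h.subset (by simp))) hm
  rwa [e] at this

/-! ### Persistence of links, and crossed edges -/

theorem lineMove_linked {c : ℕ → C} {j : ℕ} (h : c j = c (j + 1)) (m : ℕ × C) :
    lineMove c m j = lineMove c m (j + 1) := by
  have : LineComp c m.1 j ↔ LineComp c m.1 (j + 1) := by
    constructor
    · intro hj t ht
      by_cases htj : t = j + 1
      · rw [htj, ← h]; exact hj j Set.right_mem_uIcc
      · refine hj t ?_
        rw [Set.mem_uIcc] at ht ⊢
        omega
    · intro hj t ht
      by_cases htj : t = j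
      · rw [htj, h]; exact hj _ Set.right_mem_uIcc
      · refine hj t ?_
        rw [Set.mem_uIcc] at ht ⊢
        omega
  simp only [lineMove, h]
  classical exact if_congr this rfl rfl

theorem linePlay_linked {c : ℕ → C} {j : ℕ} (h : c j = c (j + 1)) (S : List (ℕ × C)) :
    linePlay c S j = linePlay c S (j + 1) := by
  induction S using List.reverseRecOn with
  | nil => exact h
  | append_singleton S m ih => rw [linePlay_concat]; exact lineMove_linked ih m

theorem linePlay_linked_of_prefix {c : ℕ → C} {j : ℕ} {S S' : List (ℕ × C)} (hp : S' <+: S)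
    (h : linePlay c S' j = linePlay c S' (j + 1)) : linePlay c S j = linePlay c S (j + 1) := by
  obtain ⟨S₀, rfl⟩ := hp
  rw [linePlay_append]
  exact linePlay_linked h S₀

theorem eq_of_linked {c : ℕ → C} {l r : ℕ} (h : ∀ j, l ≤ j → j < r → c j = c (j + 1)) :
    ∀ i, l ≤ i → i ≤ r → c i = c l := by
  intro i hi
  induction i, hi using Nat.le_induction with
  | base => intro; rfl
  | succ j hj ih => intro hr; rw [← h j hj (by omega)]; exact ih (by omega)

/-- Some move of `S` recolours both `j` and `j + 1`. -/
def Crossed (c : ℕ → C) (S : List (ℕ × C)) (j : ℕ) : Prop :=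
  ∃ S' m, S' ++ [m] <+: S ∧ LineComp (linePlay c S') m.1 j ∧ LineComp (linePlay c S') m.1 (j + 1)

/-- At the time of the crossing move both ends have the same colour, and this persists. That the
conclusion concerns the colouring before the last move is what later allows this move to be removed.
-/
theorem Crossed.linked {c : ℕ → C} {S : List (ℕ × C)} {m : ℕ × C} {j : ℕ}
    (h : Crossed c (S ++ [m]) j) : linePlay c S j = linePlay c S (j + 1) := by
  obtain ⟨S', m', hp, h₁, h₂⟩ := h
  refine linePlay_linked_of_prefix (S' := S') ?_ ?_
  · have := hp.length_le
    refine List.prefix_of_prefix_length_le ((List.prefix_append _ _).trans hp)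
      (List.prefix_append S [m]) ?_
    simpa using this
  · rw [h₁ _ Set.right_mem_uIcc, h₂ _ Set.right_mem_uIcc]

/-- Components are intervals, so a move that reaches the other side of the edge recolours both of
its ends. The conclusion has the shape required by `linePlay_filter`. -/
theorem not_crossed_Iic {c : ℕ → C} {S : List (ℕ × C)} {j : ℕ} (h : ¬ Crossed c S j) :
    ∀ S' m, S' ++ [m] <+: S → m.1 ∉ Set.Iic j → ∀ i ∈ Set.Iic j,
      ¬ LineComp (linePlay c S') m.1 i := by
  intro S' m hp hm i hi hc
  simp only [Set.mem_Iic] at hm hi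
  exact h ⟨S', m, hp, hc.mono (by rw [Set.mem_uIcc]; omega),
    hc.mono (by rw [Set.mem_uIcc]; omega)⟩

theorem not_crossed_Ioi {c : ℕ → C} {S : List (ℕ × C)} {j : ℕ} (h : ¬ Crossed c S j) :
    ∀ S' m, S' ++ [m] <+: S → m.1 ∉ Set.Ioi j → ∀ i ∈ Set.Ioi j,
      ¬ LineComp (linePlay c S') m.1 i := by
  intro S' m hp hm i hi hc
  simp only [Set.mem_Ioi] at hm hi
  exact h ⟨S', m, hp, hc.mono (by rw [Set.mem_uIcc]; omega),
    hc.mono (by rw [Set.mem_uIcc]; omega)⟩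

theorem linePlay_eq_of_not_crossed {c : ℕ → C} {S : List (ℕ × C)} {j : ℕ} (h : ¬ Crossed c S j) :
    ((∀ m ∈ S, m.1 ≤ j) → ∀ i, j < i → linePlay c S i = c i) ∧
      ((∀ m ∈ S, j < m.1) → ∀ i, i ≤ j → linePlay c S i = c i) := by
  constructor
  · intro hS i hi
    have e : S.filter (fun a => decide (a.1 ∈ Set.Ioi j)) = [] := by
      simpa [List.filter_eq_nil_iff] using fun a b h => hS (a, b) h
    have := (linePlay_filter (Set.eqOn_refl c _) S (not_crossed_Ioi h)).1 (Set.mem_Ioi.2 hi)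
    rwa [e] at this
  · intro hS i hi
    have e : S.filter (fun a => decide (a.1 ∈ Set.Iic j)) = [] := by
      simpa [List.filter_eq_nil_iff] using fun a b h => hS (a, b) h
    have := (linePlay_filter (Set.eqOn_refl c _) S (not_crossed_Iic h)).1 (Set.mem_Iic.2 hi)
    rwa [e] at this

theorem not_crossed_of_not_linked {c : ℕ → C} {S : List (ℕ × C)} {m : ℕ × C} {j : ℕ}
    (h : linePlay c S j ≠ linePlay c S (j + 1)) : ¬ Crossed c (S ++ [m]) j :=
  fun hc => h hc.linked

/-- `S` is played in `[l, r]`, gives colour `d` to all of this interval, and shows to each `i`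
in this interval all colours of `R i` that are not in `I`. -/
structure LineAchieves (c : ℕ → C) (R : ℕ → Set C) (l r : ℕ) (d : C) (I : Set C)
    (S : List (ℕ × C)) : Prop where
  mem : ∀ m ∈ S, m.1 ∈ Set.Icc l r
  flood : ∀ i ∈ Set.Icc l r, linePlay c S i = d
  hist : ∀ i ∈ Set.Icc l r, ∀ x ∈ R i, x ∉ I → x ∈ lineHist c S i

/-! ### Cutting a sequence into blocks -/

namespace LineAchieves

variable {c : ℕ → C} {R : ℕ → Set C} {l r : ℕ} {d : C} {I : Set C} {S : List (ℕ × C)}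

/-- The line form of `f₁`: the additional move shows `d` everywhere, so leaves of colour `d` could
be ignored before it. -/
theorem concat {d' : C} (hlr : l ≤ r) (h : LineAchieves c R l r d' (I ∪ {d}) S) :
    LineAchieves c R l r d I (S ++ [(l, d)]) := by
  have key : ∀ i ∈ Set.Icc l r, linePlay c (S ++ [(l, d)]) i = d := by
    intro i hi
    rw [linePlay_concat]
    have : LineComp (linePlay c S) l i := by
      intro t ht
      rw [h.flood l ⟨le_rfl, hlr⟩, h.flood t]
      rw [Set.uIcc_of_le hi.1] at ht
      exact ⟨ht.1, ht.2.trans hi.2⟩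
    simp [lineMove, this]
  refine ⟨?_, key, ?_⟩
  · intro m hm
    rw [List.mem_append] at hm
    rcases hm with hm | hm
    · exact h.mem m hm
    · simp only [List.mem_singleton] at hm
      subst hm
      exact ⟨le_rfl, hlr⟩
  · intro i hi x hx hxI
    rw [lineHist_concat, key i hi]
    by_cases hxd : x = d
    · exact Or.inl hxd
    · exact Or.inr (h.hist i hi x hx (by simp [hxI, hxd]))

theorem mono {I' : Set C} (hI : I ⊆ I') (h : LineAchieves c R l r d I S) :
    LineAchieves c R l r d I' S :=
  ⟨h.mem, h.flood, fun i hi x hx hxI => h.hist i hi x hx fun hx' => hxI (hI hx')⟩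

/-- Across an uncrossed edge the moves on either side do not notice each other, so each side keeps
just its own moves. The last clause ensures that a part cut off at the first uncrossed edge has all
its edges crossed. -/
theorem split {j : ℕ} (hl : l ≤ j) (hr : j < r) (h : LineAchieves c R l r d I S)
    (hj : ¬ Crossed c S j) :
    ∃ S₁ S₂, LineAchieves c R l j d I S₁ ∧ LineAchieves c R (j + 1) r d I S₂ ∧
      S₁.length + S₂.length = S.length ∧ ∀ i < j, Crossed c S i → Crossed c S₁ i := by
  obtain ⟨h₁, h₁'⟩ := linePlay_filter (Set.eqOn_refl c _) S (not_crossed_Iic hj)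
  obtain ⟨h₂, h₂'⟩ := linePlay_filter (Set.eqOn_refl c _) S (not_crossed_Ioi hj)
  refine ⟨S.filter (·.1 ∈ Set.Iic j), S.filter (·.1 ∈ Set.Ioi j), ⟨?_, ?_, ?_⟩, ⟨?_, ?_, ?_⟩,
    ?_, ?_⟩
  · intro m hm
    rw [List.mem_filter] at hm
    exact ⟨(h.mem m hm.1).1, by simpa using hm.2⟩
  · intro i hi
    rw [← h₁ hi.2]
    exact h.flood i ⟨hi.1, hi.2.trans hr.le⟩
  · intro i hi
    rw [← h₁' i hi.2]
    exact h.hist i ⟨hi.1, hi.2.trans hr.le⟩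
  · intro m hm
    rw [List.mem_filter] at hm
    exact ⟨by simpa using hm.2, (h.mem m hm.1).2⟩
  · intro i hi
    rw [← h₂ hi.1]
    exact h.flood i ⟨hl.trans (by have := hi.1; omega), hi.2⟩
  · intro i hi
    rw [← h₂' i hi.1]
    exact h.hist i ⟨hl.trans (by have := hi.1; omega), hi.2⟩
  · have e : S.filter (fun a => decide (a.1 ∈ Set.Ioi j)) =
        S.filter (fun a => !decide (a.1 ∈ Set.Iic j)) := by
      congr 1
      ext a
      by_cases ha : a.1 ≤ j <;> simp [ha]
      omega
    rw [e, ← List.countP_eq_length_filter, ← List.countP_eq_length_filter,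
      List.length_eq_countP_add_countP (fun a => decide (a.1 ∈ Set.Iic j)) (l := S)]
    simp only [Bool.not_eq_true, Bool.decide_eq_false]
  -- A move crossing an edge left of `j` starts on the left of the uncrossed edge, hence survives
  -- the filter; up to that moment the filtered play agrees with `S` on the left.
  · rintro i hij ⟨S', m, hp, hc₁, hc₂⟩
    have hm : m.1 ∈ Set.Iic j := by
      by_contra hm
      exact not_crossed_Iic hj S' m hp hm i hij.le hc₁
    have hnc : ¬ Crossed c S' j := fun ⟨S'', m', hp', h⟩ =>
      hj ⟨S'', m', hp'.trans ((List.prefix_append _ _).trans hp), h⟩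
    have hS' := (linePlay_filter (Set.eqOn_refl c _) S' (not_crossed_Iic hnc)).1
    have hcomp : ∀ k ≤ j, LineComp (linePlay c S') m.1 k →
        LineComp (linePlay c (S'.filter (·.1 ∈ Set.Iic j))) m.1 k := by
      intro k hk hc t ht
      rw [← hS' (Set.ordConnected_Iic.uIcc_subset hm hk ht), ← hS' hm]
      exact hc t ht
    refine ⟨S'.filter (·.1 ∈ Set.Iic j), m, ?_, hcomp i hij.le hc₁, hcomp (i + 1) hij hc₂⟩
    have := hp.filter (fun a => decide (a.1 ∈ Set.Iic j))
    rw [List.filter_append] at this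
    simpa [Set.mem_Iic.1 hm] using this

/-- If all edges are crossed, then `S` is trivial, or its last move recolours all of `[l, r]`. -/
theorem atom (hlr : l ≤ r) (h : LineAchieves c R l r d I S)
    (hc : ∀ j, l ≤ j → j < r → Crossed c S j) :
    (l = r ∧ c l = d ∧ R l ⊆ I ∪ {d} ∧ S = []) ∨
      ∃ d' S', LineAchieves c R l r d' (I ∪ {d}) S' ∧ S'.length + 1 = S.length := by
  induction S using List.reverseRecOn with
  | nil =>
    -- Without moves nothing is crossed, so the interval has no edges.
    have hlr' : l = r := by
      by_contra hne
      obtain ⟨S', m, hp, -⟩ := hc l le_rfl (by omega)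
      simp at hp
    refine Or.inl ⟨hlr', h.flood l ⟨le_rfl, hlr⟩, fun x hx => ?_, rfl⟩
    by_cases hxI : x ∈ I
    · exact Or.inl hxI
    · have := h.hist l ⟨le_rfl, hlr⟩ x hx hxI
      rw [lineHist_nil, ← linePlay_nil c, h.flood l ⟨le_rfl, hlr⟩] at this
      exact Or.inr this
  | append_singleton S m _ =>
    -- The colour `d'` is that of the interval before the last move; this move adds only `d` to the
    -- histories.
    refine Or.inr ⟨linePlay c S l, S, ⟨fun m' hm' => h.mem m' (by simp [hm']), ?_, ?_⟩, by simp⟩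
    · intro i hi
      exact eq_of_linked (fun j hj hj' => (hc j hj hj').linked) i hi.1 hi.2
    · intro i hi x hx hxI
      simp only [Set.mem_union, Set.mem_singleton_iff, not_or] at hxI
      have := h.hist i hi x hx hxI.1
      rw [lineHist_concat, h.flood i hi] at this
      exact this.resolve_left hxI.2

/-- The first interval that is not joined to the rest before the end. -/
theorem exists_first (hlr : l ≤ r) (h : LineAchieves c R l r d I S) :
    ∃ (j : ℕ) (S₁ S₂ : List (ℕ × C)), l ≤ j ∧ j ≤ r ∧ S₁.length + S₂.length = S.length ∧
      (j < r → LineAchieves c R (j + 1) r d I S₂) ∧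
      ((l = j ∧ c l = d ∧ R l ⊆ I ∪ {d} ∧ S₁ = []) ∨
        ∃ d' S', LineAchieves c R l j d' (I ∪ {d}) S' ∧ S'.length + 1 = S₁.length) := by
  classical
  by_cases hex : ∃ j, l ≤ j ∧ j < r ∧ ¬ Crossed c S j
  · obtain ⟨hlj, hjr, hj⟩ := Nat.find_spec hex
    obtain ⟨S₁, S₂, h₁, h₂, hlen, hcr⟩ := h.split hlj hjr hj
    refine ⟨Nat.find hex, S₁, S₂, hlj, hjr.le, hlen, fun _ => h₂, h₁.atom hlj fun i hi hi' => ?_⟩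
    refine hcr i hi' ?_
    by_contra hi''
    exact Nat.find_min hex hi' ⟨hi, hi'.trans hjr, hi''⟩
  · push Not at hex
    exact ⟨r, S, [], hlr, le_rfl, by simp, fun h => absurd h (lt_irrefl _), h.atom hlr hex⟩

/-- A monochromatic interval on the left is absorbed. -/
theorem extend_left {c' : ℕ → C} {m : ℕ} (hlm : l ≤ m) (hmr : m < r)
    (h : LineAchieves c' R (m + 1) r d I S) (hc : ∀ i ∈ Set.Icc l m, c' i = d) :
    ∀ i ∈ Set.Icc l r, linePlay c' S i = d := by
  intro i hi
  by_cases him : m < i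
  · exact h.flood i ⟨him, hi.2⟩
  -- Either `m` ends with the colour of `m + 1`, or the edge between them was never crossed and `m`
  -- keeps its initial colour. Both are `d`.
  have hm : linePlay c' S m = d := by
    by_cases he : linePlay c' S m = linePlay c' S (m + 1)
    · rw [he, h.flood _ ⟨le_rfl, hmr⟩]
    · have hnc : ¬ Crossed c' S m := by
        intro hcr
        obtain ⟨S', x, hp, h₁, h₂⟩ := hcr
        refine he (linePlay_linked_of_prefix ((List.prefix_append _ _).trans hp) ?_)
        rw [h₁ _ Set.right_mem_uIcc, h₂ _ Set.right_mem_uIcc]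
      rw [(linePlay_eq_of_not_crossed hnc).2 (fun x hx => (h.mem x hx).1) m le_rfl]
      exact hc m ⟨hlm, le_rfl⟩
  have hlink : ∀ j, l ≤ j → j < m → linePlay c' S j = linePlay c' S (j + 1) := fun j hj hj' =>
    linePlay_linked ((hc j ⟨hj, hj'.le⟩).trans (hc (j + 1) ⟨by omega, hj'⟩).symm) S
  rw [eq_of_linked hlink i hi.1 (by omega), ← eq_of_linked hlink m hlm le_rfl, hm]

end LineAchieves

/-! ### Merging adjacent intervals at no extra cost -/

/-- `[l, r]` can be given colour `d` in at most `N` moves. -/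
def LineCost (c : ℕ → C) (R : ℕ → Set C) (l r : ℕ) (d : C) (I : Set C) (N : ℕ) : Prop :=
  ∃ S, LineAchieves c R l r d I S ∧ S.length ≤ N

/-- `[l, r]` can be given colour `d` in at most `N` moves, the last of which recolours all of it. -/
def LineCostPos (c : ℕ → C) (R : ℕ → Set C) (l r : ℕ) (d : C) (I : Set C) (N : ℕ) : Prop :=
  ∃ d' S, LineAchieves c R l r d' (I ∪ {d}) S ∧ S.length + 1 ≤ N

theorem LineCostPos.lineCost {c : ℕ → C} {R : ℕ → Set C} {l r : ℕ} {d : C} {I : Set C} {N : ℕ}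
    (hlr : l ≤ r) (h : LineCostPos c R l r d I N) : LineCost c R l r d I N := by
  obtain ⟨d', S, hS, hN⟩ := h
  exact ⟨_, hS.concat hlr, by simpa using hN⟩

/-- A cell that already has colour `d` needs no move: it keeps this colour or is flooded along with
its neighbour, and `d` is in its history from the start. -/
theorem LineCost.cell_append {c : ℕ → C} {R : ℕ → Set C} {l r : ℕ} {d : C} {I : Set C} {N : ℕ}
    (hlr : l < r) (hc : c l = d) (hR : R l ⊆ I ∪ {d}) (h : LineCost c R (l + 1) r d I N) :
    LineCost c R l r d I N := by
  obtain ⟨S, hS, hN⟩ := h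
  refine ⟨S, ⟨fun m hm => ?_, hS.extend_left le_rfl hlr ?_, ?_⟩, hN⟩
  · have := hS.mem m hm
    exact ⟨by have := this.1; omega, this.2⟩
  · intro i hi
    rw [le_antisymm hi.2 hi.1, hc]
  · intro i hi x hx hxI
    rcases hi.1.eq_or_lt with rfl | hlt
    · have hxd : x = d := (hR hx).resolve_left hxI
      exact ⟨[], List.nil_prefix, by rw [linePlay_nil, hc, hxd]⟩
    · exact hS.hist i ⟨hlt, hi.2⟩ x hx hxI

/-- An interval whose last move recolours all of it either absorbs a cell on its right or can be
played without affecting anything on its right. -/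
theorem LineCostPos.absorb_or_join {c : ℕ → C} {R : ℕ → Set C} {l m r : ℕ} {d : C} {I : Set C}
    {a b : ℕ} (hlm : l ≤ m) (hmr : m < r) (hA : LineCostPos c R l m d I a)
    (hR : R (m + 1) ⊆ I ∪ {d}) (hB : LineCost c R (m + 1) r d I b) :
    LineCostPos c R l (m + 1) d I a ∨ LineCost c R l r d I (a + b) := by
  obtain ⟨d', S, hS, hN⟩ := hA
  -- The comparison is made just before the final move of the left block. If the colours agree, the
  -- cell `m + 1` is already flooded. If not, the edge is not crossed even by the final move, so the
  -- right side is still in its initial state.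
  by_cases he : linePlay c S m = linePlay c S (m + 1)
  · refine Or.inl ⟨d', S, ⟨fun x hx => ?_, fun i hi => ?_, fun i hi x hx hxI => ?_⟩, hN⟩
    · have := hS.mem x hx
      exact ⟨this.1, this.2.trans (Nat.le_succ m)⟩
    · rcases hi.2.eq_or_lt with rfl | hlt
      · rw [← he, hS.flood m ⟨hlm, le_rfl⟩]
      · exact hS.flood i ⟨hi.1, Nat.lt_succ_iff.1 hlt⟩
    · rcases hi.2.eq_or_lt with rfl | hlt
      · exact absurd (hR hx) hxI
      · exact hS.hist i ⟨hi.1, Nat.lt_succ_iff.1 hlt⟩ x hx hxI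
  · right
    have hS' := hS.concat hlm
    obtain ⟨S₂, hS₂, hN₂⟩ := hB
    set S₁ := S ++ [(l, d)]
    have hnc : ¬ Crossed c S₁ m := not_crossed_of_not_linked he
    have hout : Set.EqOn (linePlay c S₁) c (Set.Ioi m) := fun i hi =>
      (linePlay_eq_of_not_crossed hnc).1 (fun x hx => (hS'.mem x hx).2) i hi
    obtain ⟨hp, hh⟩ := linePlay_congr hout S₂ fun x hx => (hS₂.mem x hx).1
    have hS₂' : LineAchieves (linePlay c S₁) R (m + 1) r d I S₂ :=
      ⟨hS₂.mem, fun i hi => by rw [hp hi.1]; exact hS₂.flood i hi,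
        fun i hi => by rw [hh i hi.1]; exact hS₂.hist i hi⟩
    refine ⟨S₁ ++ S₂, ⟨fun x hx => ?_, fun i hi => ?_, fun i hi x hx hxI => ?_⟩, ?_⟩
    · rcases List.mem_append.1 hx with hx | hx
      · have := hS'.mem x hx
        exact ⟨this.1, this.2.trans hmr.le⟩
      · have := hS₂.mem x hx
        exact ⟨by have := this.1; omega, this.2⟩
    · rw [linePlay_append]
      exact hS₂'.extend_left hlm hmr hS'.flood i hi
    · by_cases him : i ≤ m
      · exact lineHist_append_left _ _ _ _ (hS'.hist i ⟨hi.1, him⟩ x hx hxI)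
      · exact lineHist_append_right _ _ _ _ (hS₂'.hist i ⟨by omega, hi.2⟩ x hx hxI)
    · simp only [S₁, List.length_append, List.length_cons, List.length_nil]
      omega

/-- Two adjacent intervals can be flooded together at no extra cost. -/
theorem LineCost.append {c : ℕ → C} {R : ℕ → Set C} (N : ℕ) : ∀ {l m r : ℕ} {d : C} {I : Set C}
    {a b : ℕ}, l ≤ m → m < r → LineCost c R l m d I a → LineCost c R (m + 1) r d I b →
    a + b = N → LineCost c R l r d I N := by
  induction N using Nat.strong_induction_on with
  | _ N ih =>
  -- Both final moves are removed, the right block receives a move to `d'` instead, and the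
  -- induction is applied to `a - 1 + b` moves; one common final move restores the total `a + b`.
  have hpp : ∀ {l m r : ℕ} {d : C} {I : Set C} {a b : ℕ}, l ≤ m → m < r →
      LineCostPos c R l m d I a → LineCostPos c R (m + 1) r d I b → a + b ≤ N →
      LineCostPos c R l r d I (a + b) := by
    rintro l m r d I a b hlm hmr ⟨d', S, hS, ha⟩ ⟨d'', S', hS', hb⟩ hab
    obtain ⟨S'', h, hlen⟩ := ih (a - 1 + b) (by omega) (a := a - 1) (b := b) hlm hmr
      ⟨S, hS, by omega⟩ ⟨_, (hS'.mono (I' := I ∪ {d} ∪ {d'}) Set.subset_union_left).concat hmr,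
        by simpa using hb⟩ rfl
    exact ⟨d', S'', h, by omega⟩
  -- The left block grows to the right, taking in one block of the right interval at a time; `s` is
  -- the length of what remains.
  have hpos : ∀ (s : ℕ) {l m r : ℕ} {d : C} {I : Set C} {a b : ℕ}, r - m = s → l ≤ m → m < r →
      LineCostPos c R l m d I a → LineCost c R (m + 1) r d I b → a + b ≤ N →
      LineCost c R l r d I (a + b) := by
    intro s
    induction s using Nat.strong_induction_on with
    | _ s ihs =>
    intro l m r d I a b hs hlm hmr hA hB hab
    obtain ⟨S, hS, hb⟩ := hB
    obtain ⟨j, S₁, S₂, hj, hjr, hlen, hS₂, hz | ⟨d', S', hS', hlen'⟩⟩ := hS.exists_first hmr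
    · obtain ⟨rfl, -, hR, rfl⟩ := hz
      rcases hA.absorb_or_join hlm hmr hR ⟨S, hS, hb⟩ with hA' | h
      · rcases hjr.eq_or_lt with rfl | hlt
        · obtain ⟨S, hS, hl⟩ := hA'.lineCost (hlm.trans (Nat.le_succ m))
          exact ⟨S, hS, by omega⟩
        · refine ihs _ (by omega) rfl (by omega) hlt hA' ⟨S₂, hS₂ hlt, ?_⟩ hab
          simp at hlen
          omega
      · exact h
    · have hA' := hpp hlm (by omega) hA ⟨d', S', hS', hlen'.le⟩ (by omega)
      rcases hjr.eq_or_lt with rfl | hlt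
      · obtain ⟨S, hS, hl⟩ := hA'.lineCost (by omega)
        exact ⟨S, hS, by omega⟩
      · obtain ⟨S, hS, hl⟩ := ihs _ (by omega) rfl (by omega) hlt hA' ⟨S₂, hS₂ hlt, le_rfl⟩
          (by omega)
        exact ⟨S, hS, by omega⟩
  -- The first block of the left interval is detached; the rest is joined to the right interval, and
  -- then the block is put back.
  have hall : ∀ (s : ℕ) {l m r : ℕ} {d : C} {I : Set C} {a b : ℕ}, m - l = s → l ≤ m → m < r →
      LineCost c R l m d I a → LineCost c R (m + 1) r d I b → a + b ≤ N →
      LineCost c R l r d I (a + b) := by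
    intro s
    induction s using Nat.strong_induction_on with
    | _ s ihs =>
    intro l m r d I a b hs hlm hmr hA hB hab
    obtain ⟨S, hS, ha⟩ := hA
    obtain ⟨j, S₁, S₂, hj, hjm, hlen, hS₂, hfst⟩ := hS.exists_first hlm
    have hrest : LineCost c R (j + 1) r d I (S₂.length + b) := by
      rcases hjm.eq_or_lt with rfl | hlt
      · obtain ⟨S', hS', hl⟩ := hB
        exact ⟨S', hS', by omega⟩
      · exact ihs _ (by omega) rfl hlt hmr ⟨S₂, hS₂ hlt, le_rfl⟩ hB (by omega)
    rcases hfst with ⟨rfl, hc, hR, rfl⟩ | ⟨d', S', hS', hlen'⟩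
    · obtain ⟨S, hS, hl⟩ := LineCost.cell_append (by omega) hc hR hrest
      simp at hlen
      exact ⟨S, hS, by omega⟩
    · obtain ⟨S, hS, hl⟩ := hpos _ rfl hj (by omega) ⟨d', S', hS', hlen'.le⟩ hrest (by omega)
      exact ⟨S, hS, by omega⟩
  intro l m r d I a b hlm hmr hA hB hab
  subst hab
  exact hall _ rfl hlm hmr hA hB le_rfl

/-- A single cell can be played through all of the finitely many colours, ending with `d`; longer
intervals follow by `LineCost.append`. -/
theorem exists_lineAchieves [Finite C] (c : ℕ → C) (R : ℕ → Set C) {l r : ℕ} (hlr : l ≤ r) (d : C)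
    (I : Set C) : ∃ S, LineAchieves c R l r d I S := by
  have cell : ∀ l, ∃ S, LineAchieves c R l l d I S := by
    intro l
    have key : ∀ s : Finset C, ∃ (d' : C) (S : List (ℕ × C)),
        LineAchieves c (fun i => R i ∩ s) l l d' I S := by
      classical
      intro s
      induction s using Finset.induction_on with
      | empty => exact ⟨c l, [], by simp, fun i hi => by rw [le_antisymm hi.2 hi.1]; rfl, by simp⟩
      | insert x s _ ih =>
        obtain ⟨d', S, hS⟩ := ih
        refine ⟨x, _, LineAchieves.concat le_rfl (d' := d') (S := S) ⟨hS.mem, hS.flood, ?_⟩⟩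
        intro i hi y hy hyI
        simp only [Set.mem_union, Set.mem_singleton_iff, not_or] at hyI
        refine hS.hist i hi y ⟨hy.1, ?_⟩ hyI.1
        simpa [hyI.2] using hy.2
    obtain ⟨d', S, hS⟩ := key (Set.toFinite (Set.univ : Set C)).toFinset
    refine ⟨_, LineAchieves.concat le_rfl (d' := d') (S := S) ?_⟩
    simp only [Set.Finite.coe_toFinset, Set.inter_univ] at hS
    exact hS.mono Set.subset_union_left
  induction r, hlr using Nat.le_induction with
  | base => exact cell l
  | succ r hr ih =>
    obtain ⟨S, hS⟩ := ih
    obtain ⟨S', hS'⟩ := cell (r + 1)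
    obtain ⟨T, hT, -⟩ := LineCost.append _ hr (Nat.lt_succ_self r) ⟨S, hS, le_rfl⟩
      ⟨S', hS', le_rfl⟩ rfl
    exact ⟨T, hT⟩

end Line

/-! ### Caterpillars -/

section Caterpillar

variable {V C : Type*} {G : SimpleGraph V}

/-- The vertices `p l, …, p r` form a path in `s`, and every vertex `v` of `s` is the vertex
`p (h v)` of this path or adjacent to it. -/
structure Caterpillar (G : SimpleGraph V) (s : Set V) (p : ℕ → V) (h : V → ℕ) (l r : ℕ) :
    Prop where
  le : l ≤ r
  mem : ∀ i ∈ Set.Icc l r, p i ∈ s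
  pos : ∀ i ∈ Set.Icc l r, h (p i) = i
  adj : ∀ i, l ≤ i → i < r → G.Adj (p i) (p (i + 1))
  pos_mem : ∀ v ∈ s, h v ∈ Set.Icc l r
  leaf : ∀ v ∈ s, v ≠ p (h v) → G.Adj v (p (h v))

/-- Adjacency in the tree of a caterpillar. -/
def CatAdj (p : ℕ → V) (h : V → ℕ) (u v : V) : Prop :=
  (u = p (h u) ∧ v = p (h v) ∧ (h u + 1 = h v ∨ h v + 1 = h u)) ∨
    (h u = h v ∧ u ≠ v ∧ (u = p (h u) ∨ v = p (h v)))

theorem CatAdj.symm {p : ℕ → V} {h : V → ℕ} {u v : V} (H : CatAdj p h u v) : CatAdj p h v u := by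
  rcases H with ⟨hu, hv, H⟩ | ⟨hh, hne, H⟩
  · exact Or.inl ⟨hv, hu, H.symm⟩
  · exact Or.inr ⟨hh.symm, hne.symm, H.symm⟩

/-- `T` is the tree of the caterpillar. -/
structure IsCatTree (T : G.Subgraph) (s : Set V) (p : ℕ → V) (h : V → ℕ) (l r : ℕ) : Prop
    extends Caterpillar G s p h l r where
  verts : T.verts = s
  adj_iff : ∀ u v, T.Adj u v ↔ u ∈ s ∧ v ∈ s ∧ CatAdj p h u v

/-- The colours of the vertices attached to the vertex `p i` of the path. -/
def leafColours (ω : V → C) (s : Set V) (p : ℕ → V) (h : V → ℕ) (i : ℕ) : Set C :=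
  {x | ∃ v ∈ s, h v = i ∧ v ≠ p i ∧ ω v = x}

theorem LineComp.congr {D : Set ℕ} [hD : D.OrdConnected] {c c' : ℕ → C} (h : Set.EqOn c c' D)
    {i j : ℕ} (hi : i ∈ D) (hj : j ∈ D) : LineComp c i j ↔ LineComp c' i j :=
  forall₂_congr fun t ht => by rw [h (hD.uIcc_subset hi hj ht), h hi]

/-! ### Play on a caterpillar tree -/

namespace IsCatTree

variable {T : G.Subgraph} {s : Set V} {p : ℕ → V} {h : V → ℕ} {l r : ℕ}

theorem adj_succ (H : IsCatTree T s p h l r) {i : ℕ} (hi : l ≤ i) (hi' : i < r) :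
    T.Adj (p i) (p (i + 1)) := by
  have h₁ : i ∈ Set.Icc l r := ⟨hi, hi'.le⟩
  have h₂ : i + 1 ∈ Set.Icc l r := ⟨by omega, hi'⟩
  refine (H.adj_iff _ _).2 ⟨H.mem _ h₁, H.mem _ h₂, Or.inl ?_⟩
  rw [H.pos _ h₁, H.pos _ h₂]
  exact ⟨rfl, rfl, Or.inl rfl⟩

theorem adj_leaf (H : IsCatTree T s p h l r) {v : V} (hv : v ∈ s) (hne : v ≠ p (h v)) :
    T.Adj v (p (h v)) := by
  have h₁ := H.pos_mem v hv
  refine (H.adj_iff _ _).2 ⟨hv, H.mem _ h₁, Or.inr ?_⟩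
  rw [H.pos _ h₁]
  exact ⟨rfl, hne, Or.inr rfl⟩

theorem eq_of_adj_leaf (H : IsCatTree T s p h l r) {v w : V} (hne : v ≠ p (h v))
    (ha : T.Adj v w) : w = p (h v) := by
  rcases ((H.adj_iff _ _).1 ha).2.2 with ⟨h₁, -⟩ | ⟨h₁, -, h₂ | h₂⟩
  · exact absurd h₁ hne
  · exact absurd h₂ hne
  · rw [h₁]; exact h₂

theorem mem_leaves (H : IsCatTree T s p h l r) {v : V} (hv : v ∈ s) (hne : v ≠ p (h v)) :
    ∃! w, T.Adj v w :=
  ⟨_, H.adj_leaf hv hne, fun _ hw => H.eq_of_adj_leaf hne hw⟩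

theorem sameComponent_path (H : IsCatTree T s p h l r) (τ : V → C) {i j : ℕ} (hi : l ≤ i)
    (hij : i ≤ j) (hj : j ≤ r) (hc : ∀ t ∈ Set.Icc i j, τ (p t) = τ (p i)) :
    SameComponent T.spanningCoe τ (p i) (p j) := by
  induction j, hij using Nat.le_induction with
  | base => exact SimpleGraph.Reachable.refl _
  | succ j hij ih =>
    refine (ih (by omega) fun t ht => hc t ⟨ht.1, by have := ht.2; omega⟩).trans
      (SimpleGraph.Adj.reachable ⟨H.adj_succ (hi.trans hij) (by omega), ?_⟩)
    rw [hc j ⟨hij, by omega⟩, hc (j + 1) ⟨by omega, le_rfl⟩]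

/-- A leaf is reached only through its anchor. So the component of a path vertex is a monochromatic
run of the path together with the leaves that share the colour of their anchor in this run. -/
theorem sameComponent_iff (H : IsCatTree T s p h l r) (τ : V → C) {i : ℕ}
    (hi : i ∈ Set.Icc l r) {v : V} (hv : v ∈ s) :
    SameComponent T.spanningCoe τ (p i) v ↔
      LineComp (τ ∘ p) i (h v) ∧ τ v = τ (p (h v)) := by
  constructor
  · intro hc
    rw [SameComponent, SimpleGraph.reachable_iff_reflTransGen] at hc
    clear hv
    suffices v ∈ s ∧ LineComp (τ ∘ p) i (h v) ∧ τ v = τ (p (h v)) from this.2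
    induction hc with
    | refl =>
      refine ⟨H.mem i hi, ?_, by rw [H.pos i hi]⟩
      rw [H.pos i hi]
      intro t ht
      rw [Set.uIcc_self, Set.mem_singleton_iff] at ht
      rw [ht]
    | @tail u w _ hadj ih =>
      obtain ⟨hus, hcu, hτu⟩ := ih
      obtain ⟨ha, hτ⟩ := hadj
      obtain ⟨-, hws, hE⟩ := (H.adj_iff _ _).1 ha
      refine ⟨hws, ?_⟩
      rcases hE with ⟨hu, hw, hE⟩ | ⟨hE, -⟩
      · refine ⟨fun t ht => ?_, by rw [← hw]⟩
        by_cases htw : t = h w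
        · have := hcu (h u) Set.right_mem_uIcc
          simp only [Function.comp_apply] at this ⊢
          rw [htw, ← hw, ← hτ, hτu, this]
        · refine hcu t ?_
          rw [Set.mem_uIcc] at ht ⊢
          omega
      · exact ⟨hE ▸ hcu, by rw [← hE, ← hτu, hτ]⟩
  · rintro ⟨hc, hτ⟩
    have hpath : SameComponent T.spanningCoe τ (p i) (p (h v)) := by
      have hm := H.pos_mem v hv
      rcases le_total i (h v) with hle | hle
      · refine H.sameComponent_path τ hi.1 hle hm.2 fun t ht => ?_
        exact hc t (Set.Icc_subset_uIcc ht)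
      · refine (H.sameComponent_path τ hm.1 hle hi.2 fun t ht => ?_).symm
        exact (hc t (Set.Icc_subset_uIcc' ht)).trans (hc _ Set.right_mem_uIcc).symm
    by_cases hne : v = p (h v)
    · rwa [← hne] at hpath
    · exact hpath.trans (SimpleGraph.Adj.reachable ⟨(H.adj_leaf hv hne).symm, hτ.symm⟩)

open Classical in
/-- Playing on the tree of a caterpillar is playing on a line; a leaf joins the path as soon as the
vertex to which it is attached takes the colour of the leaf. -/
theorem play_eq (H : IsCatTree T s p h l r) (ω : V → C) (S : List (V × C))
    (hS : ∀ m ∈ S, m.1 ∈ p '' Set.Icc l r) : ∀ v ∈ s,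
    play T.spanningCoe ω S v =
      if ω v ∈ lineHist (ω ∘ p) (S.map fun m => (h m.1, m.2)) (h v) then
        linePlay (ω ∘ p) (S.map fun m => (h m.1, m.2)) (h v) else ω v := by
  induction S using List.reverseRecOn with
  | nil =>
    intro v hv
    simp only [play, List.map_nil, List.foldl_nil, lineHist_nil, linePlay_nil, Function.comp_apply]
    split_ifs with h
    · exact h
    · rfl
  | append_singleton S m ih =>
    replace ih := ih fun m hm => hS m (by simp [hm])
    obtain ⟨j, hj, hm⟩ := hS m (by simp)
    set S' := S.map fun m => (h m.1, m.2)
    set τ := play T.spanningCoe ω S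
    have hτ : Set.EqOn (τ ∘ p) (linePlay (ω ∘ p) S') (Set.Icc l r) := by
      intro i hi
      have := ih (p i) (H.mem i hi)
      rw [H.pos i hi, if_pos ⟨[], List.nil_prefix, rfl⟩] at this
      exact this
    intro v hv
    have hvm := H.pos_mem v hv
    have e₁ : play T.spanningCoe ω (S ++ [m]) = playMove T.spanningCoe τ m := by
      simp [play, τ]
    have e₂ : (S ++ [m]).map (fun m => (h m.1, m.2)) = S' ++ [(j, m.2)] := by
      simp [S', ← hm, H.pos j hj]
    have hcomp : SameComponent T.spanningCoe τ m.1 v ↔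
        LineComp (linePlay (ω ∘ p) S') j (h v) ∧ τ v = linePlay (ω ∘ p) S' (h v) := by
      rw [← hm, H.sameComponent_iff τ hj hv, LineComp.congr hτ hj hvm, ← hτ hvm]
      rfl
    rw [e₁, e₂]
    by_cases hh : ω v ∈ lineHist (ω ∘ p) S' (h v)
    · rw [if_pos (lineHist_append_left _ _ _ _ hh), linePlay_concat]
      have hv' := ih v hv
      rw [if_pos hh] at hv'
      simp only [playMove, lineMove, hcomp, hv', and_true]
    -- The leaf still has its initial colour, which its anchor has not taken so far, so this move
    -- misses it. If the anchor takes that colour now, the two branches of the formula agree.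
    · have hv' := ih v hv
      rw [if_neg hh] at hv'
      have hne : ¬ SameComponent T.spanningCoe τ m.1 v := by
        rw [hcomp, hv']
        rintro ⟨-, he⟩
        exact hh (he ▸ linePlay_mem_lineHist _ _ _)
      rw [lineHist_concat]
      simp only [playMove, hne, if_false, Set.mem_insert_iff, hh, or_false, hv']
      split_ifs with he
      · exact he
      · rfl

theorem play_path (H : IsCatTree T s p h l r) (ω : V → C) {S : List (V × C)}
    (hS : ∀ m ∈ S, m.1 ∈ p '' Set.Icc l r) {i : ℕ} (hi : i ∈ Set.Icc l r) :
    play T.spanningCoe ω S (p i) = linePlay (ω ∘ p) (S.map fun m => (h m.1, m.2)) i := by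
  have := H.play_eq ω S hS (p i) (H.mem i hi)
  rwa [H.pos i hi, if_pos ⟨[], List.nil_prefix, rfl⟩] at this

theorem mem_path_iff (H : IsCatTree T s p h l r) {v : V} (hv : v ∈ s) :
    v ∈ p '' Set.Icc l r ↔ v = p (h v) := by
  constructor
  · rintro ⟨i, hi, rfl⟩
    rw [H.pos i hi]
  · intro hv'
    exact ⟨h v, H.pos_mem v hv, hv'.symm⟩

theorem exists_path (H : IsCatTree T s p h l r) {j : ℕ} (hj : l ≤ j) (hjr : j ≤ r) :
    ∃ w : T.spanningCoe.Walk (p l) (p j), w.IsPath ∧ ∀ v, v ∈ w.support ↔ v ∈ p '' Set.Icc l j := by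
  induction j, hj using Nat.le_induction with
  | base => exact ⟨.nil, .nil, by simp⟩
  | succ j hj ih =>
    obtain ⟨w, hw, hs⟩ := ih (by omega)
    have ha : T.spanningCoe.Adj (p j) (p (j + 1)) := H.adj_succ hj (by omega)
    refine ⟨w.concat ha, hw.concat ?_ ha, fun v => ?_⟩
    · rw [hs]
      rintro ⟨i, hi, he⟩
      have h₁ := H.pos i ⟨hi.1, hi.2.trans (by omega)⟩
      rw [he, H.pos (j + 1) ⟨by omega, hjr⟩] at h₁
      have := hi.2
      omega
    · rw [SimpleGraph.Walk.support_concat, List.mem_append,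
        List.mem_singleton, hs]
      constructor
      · rintro (⟨i, hi, rfl⟩ | rfl)
        · exact ⟨i, ⟨hi.1, hi.2.trans (Nat.le_succ j)⟩, rfl⟩
        · exact ⟨j + 1, ⟨by omega, le_rfl⟩, rfl⟩
      · rintro ⟨i, hi, rfl⟩
        rcases hi.2.eq_or_lt with rfl | hlt
        · exact Or.inr rfl
        · exact Or.inl ⟨i, ⟨hi.1, Nat.lt_succ_iff.1 hlt⟩, rfl⟩

/-- Every edge is a bridge: a path edge is the only one leaving the set of vertices positioned at or
before its left end, and a leaf edge the only one at its leaf. -/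
theorem isAcyclic (H : IsCatTree T s p h l r) : T.spanningCoe.IsAcyclic := by
  have closed : ∀ {u v : V} (P : V → Prop), P u → ¬ P v →
      (∀ w w', T.Adj w w' → P w → ¬ P w' → w = u ∧ w' = v) →
      ¬ (T.spanningCoe.deleteEdges {s(u, v)}).Reachable u v := by
    intro u v P hu hv hP hr
    rw [SimpleGraph.reachable_iff_reflTransGen] at hr
    refine hv ?_
    clear hv
    suffices ∀ w, Relation.ReflTransGen (T.spanningCoe.deleteEdges {s(u, v)}).Adj u w → P w from
      this v hr
    intro w hw
    induction hw with
    | refl => exact hu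
    | @tail a b _ hab ih =>
      rw [SimpleGraph.deleteEdges_adj] at hab
      by_contra hb
      obtain ⟨rfl, rfl⟩ := hP a b hab.1 ih hb
      exact hab.2 rfl
  have hcons : ∀ u v, u = p (h u) → v = p (h v) → h u + 1 = h v →
      ¬ (T.spanningCoe.deleteEdges {s(u, v)}).Reachable u v := by
    intro u v hu hv huv
    refine closed (fun w => h w ≤ h u) le_rfl (by omega) ?_
    intro w w' ha hw hw'
    rcases ((H.adj_iff _ _).1 ha).2.2 with ⟨h₁, h₂, h₃⟩ | ⟨h₁, -⟩
    · rw [h₁, h₂, hu, hv, show h w = h u by omega, show h w' = h v by omega]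
      simp only [← hu, ← hv, and_self]
    · omega
  have hleaf : ∀ u v, h u = h v → u ≠ v → u = p (h u) →
      ¬ (T.spanningCoe.deleteEdges {s(v, u)}).Reachable v u := by
    intro u v huv hne hu
    refine closed (fun w => w = v) rfl hne ?_
    rintro w w' ha rfl -
    refine ⟨rfl, ?_⟩
    rw [H.eq_of_adj_leaf ?_ ha, ← huv, ← hu]
    rw [← huv, ← hu]
    exact hne.symm
  rw [SimpleGraph.isAcyclic_iff_forall_adj_isBridge]
  intro u v ha
  rw [SimpleGraph.isBridge_iff]
  rcases ((H.adj_iff _ _).1 ha).2.2 with ⟨h₁, h₂, h₃ | h₃⟩ | ⟨h₁, hne, h₂ | h₂⟩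
  · exact hcons u v h₁ h₂ h₃
  · rw [SimpleGraph.reachable_comm, Sym2.eq_swap]
    exact hcons v u h₂ h₁ h₃
  · rw [SimpleGraph.reachable_comm, Sym2.eq_swap]
    exact hleaf u v h₁ hne h₂
  · exact hleaf v u h₁.symm hne.symm h₂

theorem connected (H : IsCatTree T s p h l r) : T.coe.Connected := by
  have hm : ∀ {v}, v ∈ s → v ∈ T.verts := fun hv => H.verts ▸ hv
  have hl : l ∈ Set.Icc l r := ⟨le_rfl, H.le⟩
  have hpath : ∀ i (hi : i ∈ Set.Icc l r),
      T.coe.Reachable ⟨p l, hm (H.mem l hl)⟩ ⟨p i, hm (H.mem i hi)⟩ := by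
    rintro i ⟨hi, hir⟩
    induction i, hi using Nat.le_induction with
    | base => exact SimpleGraph.Reachable.refl _
    | succ i hi ih =>
      exact (ih (by omega)).trans (SimpleGraph.Adj.reachable (H.adj_succ hi hir))
  have hall : ∀ v : T.verts, T.coe.Reachable ⟨p l, hm (H.mem l hl)⟩ v := by
    rintro ⟨v, hv⟩
    have hv' : v ∈ s := H.verts ▸ hv
    by_cases hne : v = p (h v)
    · have := hpath (h v) (H.pos_mem v hv')
      simp only [← hne] at this
      exact this
    · exact (hpath (h v) (H.pos_mem v hv')).trans
        (SimpleGraph.Adj.reachable (H.adj_leaf hv' hne)).symm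
  have : Nonempty T.verts := ⟨⟨p l, hm (H.mem l hl)⟩⟩
  exact ⟨fun u v => (hall u).symm.trans (hall v)⟩

theorem isTree (H : IsCatTree T s p h l r) : T.coe.IsTree :=
  ⟨H.connected, H.isAcyclic.embedding T.coeEmbeddingSpanningCoe⟩

end IsCatTree

theorem Caterpillar.exists_isCatTree {s : Set V} {p : ℕ → V} {h : V → ℕ} {l r : ℕ}
    (H : Caterpillar G s p h l r) : ∃ T : G.Subgraph, IsCatTree T s p h l r := by
  refine ⟨⟨s, fun u v => u ∈ s ∧ v ∈ s ∧ CatAdj p h u v, ?_, fun h => h.1,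
    ⟨fun u v h => ⟨h.2.1, h.1, h.2.2.symm⟩⟩⟩, ⟨H, rfl, fun _ _ => Iff.rfl⟩⟩
  rintro u v ⟨hu, hv, ⟨h₁, h₂, h₃⟩ | ⟨h₁, hne, h₂⟩⟩
  · have hu' := H.pos_mem u hu
    have hv' := H.pos_mem v hv
    rcases h₃ with h₃ | h₃
    · have := H.adj (h u) hu'.1 (by have := hv'.2; omega)
      rwa [h₃, ← h₁, ← h₂] at this
    · have := H.adj (h v) hv'.1 (by have := hu'.2; omega)
      rw [h₃, ← h₁, ← h₂] at this
      exact this.symm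
  · rcases h₂ with h₂ | h₂
    · have := H.leaf v hv (by rw [← h₁, ← h₂]; exact hne.symm)
      rw [← h₁, ← h₂] at this
      exact this.symm
    · have := H.leaf u hu (by rw [h₁, ← h₂]; exact hne)
      rwa [h₁, ← h₂] at this

/-! ### Trees that are caterpillars -/

theorem support_subset_verts {T : G.Subgraph} {u v : V} (w : T.spanningCoe.Walk u v)
    (hu : u ∈ T.verts) : ∀ x ∈ w.support, x ∈ T.verts := by
  induction w with
  | nil => simpa using hu
  | cons ha w ih =>
    intro x hx
    rw [SimpleGraph.Walk.support_cons, List.mem_cons] at hx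
    rcases hx with rfl | hx
    · exact hu
    · exact ih (T.edge_vert (T.adj_symm ha)) x hx

theorem isAcyclic_spanningCoe {T : G.Subgraph} (hT : T.coe.IsAcyclic) :
    T.spanningCoe.IsAcyclic := by
  intro v w hw
  have hv : v ∈ T.verts := T.edge_vert (w.adj_snd hw.not_nil)
  have e := w.map_induce (support_subset_verts w hv)
  rw [← e] at hw
  exact hT _ hw.of_map

/-- A tree whose vertices off the path from `r₁` to `r₂` are leaves is a caterpillar. -/
theorem exists_isCatTree_of_isTree {T : G.Subgraph} (hT : T.coe.IsTree) {r₁ r₂ : V}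
    (h₁ : r₁ ∈ T.verts) (h₂ : r₂ ∈ T.verts)
    (hbare : ∀ v ∈ T.verts, (∀ q : T.spanningCoe.Walk r₁ r₂, q.IsPath → v ∉ q.support) →
      ∃! w, T.Adj v w) (l : ℕ) :
    ∃ p h r, IsCatTree T T.verts p h l r ∧ p l = r₁ ∧ p r = r₂ := by
  classical
  have hac := isAcyclic_spanningCoe hT.isAcyclic
  obtain ⟨q, hq⟩ : ∃ q : T.spanningCoe.Walk r₁ r₂, q.IsPath := by
    obtain ⟨q⟩ := hT.connected.preconnected ⟨r₁, h₁⟩ ⟨r₂, h₂⟩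
    exact ⟨(q.map T.coeEmbeddingSpanningCoe.toHom).bypass, SimpleGraph.Walk.bypass_isPath _⟩
  have hqv : ∀ k, q.getVert k ∈ T.verts := fun k =>
    support_subset_verts q h₁ _ (q.getVert_mem_support k)
  have hleaf : ∀ v ∈ T.verts, v ∉ q.support → ∃! w, T.Adj v w := by
    intro v hv hvq
    refine hbare v hv fun q' hq' => ?_
    have := congrArg Subtype.val ((hac.subsingleton_path _ _).elim ⟨q', hq'⟩ ⟨q, hq⟩)
    simp only at this
    rwa [this]
  -- Two adjacent leaves off the path would form a whole component of the tree, missing `r₁`.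
  have hnbr : ∀ v w, T.Adj v w → v ∉ q.support → w ∈ q.support := by
    intro v w ha hv
    by_contra hw
    obtain ⟨v', -, hv'⟩ := hleaf v (T.edge_vert ha) hv
    obtain ⟨w', -, hw'⟩ := hleaf w (T.edge_vert (T.adj_symm ha)) hw
    obtain ⟨q'⟩ := hT.connected.preconnected ⟨v, T.edge_vert ha⟩ ⟨r₁, h₁⟩
    have hr := (q'.map T.coeEmbeddingSpanningCoe.toHom).reachable
    rw [SimpleGraph.reachable_iff_reflTransGen] at hr
    have key : ∀ x, Relation.ReflTransGen T.spanningCoe.Adj v x → x = v ∨ x = w := by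
      intro x hx
      induction hx with
      | refl => exact Or.inl rfl
      | tail _ hxy ih =>
        rcases ih with rfl | rfl
        · exact Or.inr ((hv' _ hxy).trans (hv' _ ha).symm)
        · exact Or.inl ((hw' _ hxy).trans (hw' _ (T.adj_symm ha)).symm)
    rcases key r₁ hr with rfl | rfl
    · exact hv q.start_mem_support
    · exact hw q.start_mem_support
  have hpos : ∀ v, ∃ k, k ≤ q.length ∧ (v ∈ q.support → q.getVert k = v) ∧
      (v ∈ T.verts → v ∉ q.support → T.Adj v (q.getVert k)) := by
    intro v
    by_cases hv : v ∈ q.support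
    · obtain ⟨k, hk, hkl⟩ := SimpleGraph.Walk.mem_support_iff_exists_getVert.1 hv
      exact ⟨k, hkl, fun _ => hk, fun _ h => absurd hv h⟩
    · by_cases hvT : v ∈ T.verts
      · obtain ⟨w, hw, -⟩ := hleaf v hvT hv
        obtain ⟨k, hk, hkl⟩ :=
          SimpleGraph.Walk.mem_support_iff_exists_getVert.1 (hnbr v w hw hv)
        exact ⟨k, hkl, fun h => absurd h hv, fun _ _ => hk ▸ hw⟩
      · exact ⟨0, Nat.zero_le _, fun h => absurd h hv, fun h => absurd h hvT⟩
  choose k hkl hk hk' using hpos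
  have hinj := hq.getVert_injOn
  have hkg : ∀ i ≤ q.length, k (q.getVert i) = i := fun i hi =>
    hinj (hkl _) hi (hk _ (q.getVert_mem_support i))
  have hsupp : ∀ v, v ∈ q.support ↔ v = q.getVert (k v) :=
    fun v => ⟨fun h => (hk v h).symm, fun h => h ▸ q.getVert_mem_support _⟩
  -- A chord would be a second path beside the segment of `q` between its ends; uniqueness of paths
  -- in a forest forces that segment to have length one.
  have hchord : ∀ a b, a < b → b ≤ q.length → T.Adj (q.getVert a) (q.getVert b) → a + 1 = b := by
    intro a b hab hb ha
    have ha' : T.spanningCoe.Adj (q.getVert a) ((q.drop a).getVert (b - a)) := by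
      rw [SimpleGraph.Walk.drop_getVert, show a + (b - a) = b by omega]
      exact ha
    have := congrArg (fun x => (Subtype.val x).length)
      ((hac.subsingleton_path _ _).elim ⟨(q.drop a).take (b - a), (hq.drop a).take _⟩
        ⟨ha'.toWalk, SimpleGraph.Walk.IsPath.of_adj ha'⟩)
    simp only [SimpleGraph.Walk.take_length, SimpleGraph.Walk.drop_length,
      SimpleGraph.Walk.length_cons, SimpleGraph.Walk.length_nil] at this
    omega
  have hshift : ∀ v, l + k v - l = k v := fun v => by omega
  refine ⟨fun i => q.getVert (i - l), fun v => l + k v, l + q.length,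
    ⟨⟨by omega, fun i _ => hqv _, fun i hi => ?_, fun i hi hi' => ?_, fun v _ => ?_, ?_⟩, rfl, ?_⟩,
    by simp, by simp⟩
  · have := hkg (i - l) (by have := hi.2; omega)
    have := hi.1
    omega
  · have := q.adj_getVert_succ (i := i - l) (by omega)
    rw [show i + 1 - l = i - l + 1 by omega]
    exact T.adj_sub this
  · have := hkl v
    exact ⟨by omega, by omega⟩
  · intro v hv hne
    rw [hshift] at hne ⊢
    exact T.adj_sub (hk' v hv fun h => hne ((hsupp v).1 h))
  · intro u v
    simp only [CatAdj, hshift]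
    constructor
    · intro ha
      refine ⟨T.edge_vert ha, T.edge_vert (T.adj_symm ha), ?_⟩
      have off : ∀ {u v}, T.Adj u v → u ∉ q.support → k u = k v ∧ v = q.getVert (k v) := by
        intro u v ha hu
        have hv : v = q.getVert (k u) :=
          (hleaf u (T.edge_vert ha) hu).unique ha (hk' u (T.edge_vert ha) hu)
        have : k u = k v := by rw [hv, hkg _ (hkl u)]
        exact ⟨this, this ▸ hv⟩
      by_cases hu : u ∈ q.support
      · by_cases hv : v ∈ q.support
        · refine Or.inl ⟨(hsupp u).1 hu, (hsupp v).1 hv, ?_⟩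
          have ha' := ha
          rw [(hsupp u).1 hu, (hsupp v).1 hv] at ha'
          rcases lt_trichotomy (k u) (k v) with hlt | heq | hlt
          · left
            have := hchord _ _ hlt (hkl v) ha'
            omega
          · rw [heq] at ha'
            exact absurd rfl ha'.ne
          · right
            have := hchord _ _ hlt (hkl u) (T.adj_symm ha')
            omega
        · obtain ⟨e₁, e₂⟩ := off (T.adj_symm ha) hv
          exact Or.inr ⟨by omega, ha.ne, Or.inl e₂⟩
      · obtain ⟨e₁, e₂⟩ := off ha hu
        exact Or.inr ⟨by omega, ha.ne, Or.inr e₂⟩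
    · rintro ⟨hu, hv, ⟨e₁, e₂, e₃⟩ | ⟨e₁, hne, e₂⟩⟩
      · have adj : ∀ {u v}, u = q.getVert (k u) → v = q.getVert (k v) → k u + 1 = k v →
            T.Adj u v := by
          intro u v e₁ e₂ e₃
          have : T.spanningCoe.Adj _ _ :=
            q.adj_getVert_succ (i := k u) (by have := hkl v; omega)
          rw [e₃, ← e₁, ← e₂] at this
          exact this
        rcases e₃ with e₃ | e₃
        · exact adj e₁ e₂ (by omega)
        · exact T.adj_symm (adj e₂ e₁ (by omega))
      · have e₁' : k u = k v := by omega
        have adj : ∀ {u v}, u ∈ T.verts → k u = k v → u ≠ v → v = q.getVert (k v) → T.Adj u v := by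
          intro u v hu e₁ hne e₂
          have := hk' u hu fun h => hne (by rw [(hsupp u).1 h, e₂, e₁])
          rwa [e₁, ← e₂] at this
        rcases e₂ with e₂ | e₂
        · exact T.adj_symm (adj hv e₁'.symm hne.symm e₂)
        · exact adj hu e₁' hne e₂

end Caterpillar

/-! ### Caterpillars on the board -/

section Board

variable {n : ℕ} {C : Type*}

theorem Caterpillar.induce_connected {V : Type*} {G : SimpleGraph V} {s : Set V} {p : ℕ → V}
    {h : V → ℕ} {l r : ℕ} (H : Caterpillar G s p h l r) : (G.induce s).Connected := by
  obtain ⟨T, hT⟩ := H.exists_isCatTree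
  have hv := hT.verts
  subst hv
  exact hT.connected.mono fun u v huv => T.adj_sub huv

namespace IsCatTree

variable {T : (boardGraph n).Subgraph} {s : Set (Square n)} {p : ℕ → Square n} {h : Square n → ℕ}
  {l r : ℕ}

theorem treePath_eq (H : IsCatTree T s p h l r) : treePath T (p l) (p r) = p '' Set.Icc l r := by
  obtain ⟨w, hw, hs⟩ := H.exists_path H.le le_rfl
  ext v
  rw [← hs]
  constructor
  · rintro ⟨q, hq, hv⟩
    have := congrArg Subtype.val ((H.isAcyclic.subsingleton_path _ _).elim ⟨q, hq⟩ ⟨w, hw⟩)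
    simp only at this
    rwa [← this]
  · exact fun hv => ⟨w, hw, hv⟩

theorem bare_subset (H : IsCatTree T s p h l r) : bare T ⊆ treePath T (p l) (p r) := by
  rintro v ⟨hv, hl⟩
  have hv' : v ∈ s := H.verts ▸ hv
  rw [H.treePath_eq, H.mem_path_iff hv']
  by_contra hne
  exact hl (H.mem_leaves hv' hne)

/-- An end of the path may itself be a leaf of `T`, but flooding the path links it anyway, so only
leaves off the path impose a condition on histories. -/
theorem achieves_iff (H : IsCatTree T s p h l r) (ω : Square n → C) {z : Param n C}
    (h₁ : p l = z.r₁) (h₂ : p r = z.r₂) {S : List (Square n × C)}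
    (hS : ∀ m ∈ S, m.1 ∈ p '' Set.Icc l r) :
    Achieves ω z T S ↔ LineAchieves (ω ∘ p) (leafColours ω s p h) l r z.d z.I
      (S.map fun m => (h m.1, m.2)) := by
  classical
  have ht : treePath T z.r₁ z.r₂ = p '' Set.Icc l r := by rw [← h₁, ← h₂, H.treePath_eq]
  have hl : l ∈ Set.Icc l r := ⟨le_rfl, H.le⟩
  unfold Achieves
  rw [ht]
  constructor
  · rintro ⟨-, hflood, hleaf⟩
    have hfl : ∀ i ∈ Set.Icc l r, linePlay (ω ∘ p) (S.map fun m => (h m.1, m.2)) i = z.d := by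
      intro i hi
      rw [← H.play_path ω hS hi]
      exact hflood _ ⟨i, hi, rfl⟩
    refine ⟨fun m hm => ?_, hfl, ?_⟩
    · obtain ⟨m', hm', rfl⟩ := List.mem_map.1 hm
      obtain ⟨i, hi, he⟩ := hS m' hm'
      rw [← he, H.pos i hi]
      exact hi
    · rintro i hi x ⟨v, hv, rfl, hne, rfl⟩ hxI
      have hp : p (h v) ∈ p '' Set.Icc l r := ⟨h v, hi, rfl⟩
      have hc := hleaf v (H.mem_leaves hv hne) hxI (p (h v)) (Or.inr hp) v (Or.inl rfl)
      have hpl := H.play_eq ω S hS v hv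
      split_ifs at hpl with hh
      · exact hh
      · rw [((H.sameComponent_iff _ hi hv).1 hc).2, H.play_path ω hS hi] at hpl
        rw [← hpl]
        exact linePlay_mem_lineHist _ _ _
  · intro hL
    have hflood : ∀ v ∈ p '' Set.Icc l r, play T.spanningCoe ω S v = z.d := by
      rintro _ ⟨i, hi, rfl⟩
      rw [H.play_path ω hS hi]
      exact hL.flood i hi
    have hcomp : ∀ u ∈ s, play T.spanningCoe ω S u = z.d →
        SameComponent T.spanningCoe (play T.spanningCoe ω S) (p l) u := by
      intro u hu hud
      have hum := H.pos_mem u hu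
      refine (H.sameComponent_iff _ hl hu).2 ⟨fun t ht => ?_, ?_⟩
      · have : t ∈ Set.Icc l r := Set.ordConnected_Icc.uIcc_subset hl hum ht
        simp only [Function.comp_apply]
        rw [hflood _ ⟨t, this, rfl⟩, hflood _ ⟨l, hl, rfl⟩]
      · rw [hud, hflood _ ⟨_, hum, rfl⟩]
    refine ⟨hS, hflood, fun v hv hvI => ?_⟩
    have hvs : v ∈ s := by
      obtain ⟨w, hw, -⟩ := hv
      exact H.verts ▸ T.edge_vert hw
    have hvd : play T.spanningCoe ω S v = z.d := by
      by_cases hne : v = p (h v)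
      · exact hflood v ((H.mem_path_iff hvs).2 hne)
      · have hm := H.pos_mem v hvs
        rw [H.play_eq ω S hS v hvs,
          if_pos (hL.hist (h v) hm (ω v) ⟨v, hvs, rfl, hne, rfl⟩ hvI), hL.flood _ hm]
    have hall : ∀ u ∈ insert v (p '' Set.Icc l r),
        SameComponent T.spanningCoe (play T.spanningCoe ω S) (p l) u := by
      rintro u (rfl | ⟨i, hi, rfl⟩)
      · exact hcomp u hvs hvd
      · exact hcomp _ (H.mem i hi) (hflood _ ⟨i, hi, rfl⟩)
    exact fun u hu w hw => (hall u hu).symm.trans (hall w hw)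

end IsCatTree

theorem Caterpillar.f_le {ω : Square n → C} {z : Param n C} {p : ℕ → Square n} {h : Square n → ℕ}
    {l r : ℕ} (H : Caterpillar (boardGraph n) (between z.b₁ z.b₂) p h l r) (h₁ : p l = z.r₁)
    (h₂ : p r = z.r₂) {S : List (ℕ × C)}
    (hS : LineAchieves (ω ∘ p) (leafColours ω (between z.b₁ z.b₂) p h) l r z.d z.I S) :
    f ω z ≤ S.length := by
  obtain ⟨T, hT⟩ := H.exists_isCatTree
  have hmap : (S.map fun m => (p m.1, m.2)).map (fun m => (h m.1, m.2)) = S := by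
    rw [List.map_map]
    conv_rhs => rw [← List.map_id S]
    refine List.map_congr_left fun m hm => ?_
    simp [H.pos m.1 (hS.mem m hm)]
  refine sInf_le ⟨T, ⟨hT.verts, hT.isTree⟩, ?_, S.map fun m => (p m.1, m.2), ?_, by simp⟩
  · rw [← h₁, ← h₂]
    exact hT.bare_subset
  · rw [hT.achieves_iff ω h₁ h₂, hmap]
    · exact hS
    · intro m hm
      obtain ⟨m', hm', rfl⟩ := List.mem_map.1 hm
      exact ⟨m'.1, hS.mem m' hm', rfl⟩

theorem exists_caterpillar {b₁ b₂ : Border n} {r₁ r₂ : Square n} {T : (boardGraph n).Subgraph}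
    (hT : T ∈ spanningTrees b₁ b₂) (hbare : bare T ⊆ treePath T r₁ r₂) (h₁ : r₁ ∈ between b₁ b₂)
    (h₂ : r₂ ∈ between b₁ b₂) (l : ℕ) :
    ∃ p h r, IsCatTree T (between b₁ b₂) p h l r ∧ p l = r₁ ∧ p r = r₂ := by
  obtain ⟨hv, hT⟩ := hT
  rw [← hv] at h₁ h₂ ⊢
  refine exists_isCatTree_of_isTree hT h₁ h₂ (fun v hv hq => ?_) l
  by_contra hl
  obtain ⟨q, hq', hv'⟩ := hbare ⟨hv, hl⟩
  exact hq q hq' hv'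

/-- The infimum is attained because `ℕ∞` is well ordered. The first index `l` is free so that two
caterpillars can be numbered consecutively when they are joined. -/
theorem exists_of_f_ne_top {ω : Square n → C} {z : Param n C} (hz : z ∈ Z n C) (hf : f ω z ≠ ⊤)
    (l : ℕ) :
    ∃ p h r S, Caterpillar (boardGraph n) (between z.b₁ z.b₂) p h l r ∧ p l = z.r₁ ∧ p r = z.r₂ ∧
      LineAchieves (ω ∘ p) (leafColours ω (between z.b₁ z.b₂) p h) l r z.d z.I S ∧
      f ω z = S.length := by
  obtain ⟨T, hT, hbare, S, hS, hlen⟩ : f ω z ∈ {m : ℕ∞ | ∃ T ∈ spanningTrees z.b₁ z.b₂,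
      bare T ⊆ treePath T z.r₁ z.r₂ ∧
        ∃ S : List (Square n × C), Achieves ω z T S ∧ m = S.length} := by
    refine csInf_mem ?_
    by_contra hne
    rw [Set.not_nonempty_iff_eq_empty] at hne
    exact hf (by rw [f, hne, sInf_empty])
  obtain ⟨p, h, r, H, h₁, h₂⟩ := exists_caterpillar hT hbare hz.2.1 hz.2.2.1 l
  refine ⟨p, h, r, _, H.toCaterpillar, h₁, h₂, (H.achieves_iff ω h₁ h₂ ?_).1 hS, by simpa using hlen⟩
  rw [← H.treePath_eq, h₁, h₂]
  exact hS.1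

theorem f_ne_top [Finite C] (ω : Square n → C) {z : Param n C} (hz : z ∈ Z n C) : f ω z ≠ ⊤ := by
  obtain ⟨T, hT, hbare⟩ := hz.2.2.2.1
  obtain ⟨p, h, r, H, h₁, h₂⟩ := exists_caterpillar hT hbare hz.2.1 hz.2.2.1 0
  obtain ⟨S, hS⟩ := exists_lineAchieves (ω ∘ p) (leafColours ω (between z.b₁ z.b₂) p h) H.le z.d z.I
  exact ne_top_of_le_ne_top (ENat.natCast_ne_top _) (H.toCaterpillar.f_le h₁ h₂ hS)

theorem Caterpillar.mem_Z {b₁ b₂ : Border n} {p : ℕ → Square n} {h : Square n → ℕ} {l r : ℕ}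
    (H : Caterpillar (boardGraph n) (between b₁ b₂) p h l r) (hb : b₁ < b₂)
    (h₁ : Incident (p l) b₁) (h₂ : Incident (p r) b₂) (d : C) (I : Set C) :
    (⟨b₁, b₂, p l, p r, d, I⟩ : Param n C) ∈ Z n C := by
  obtain ⟨T, hT⟩ := H.exists_isCatTree
  exact ⟨⟨hb, H.induce_connected⟩, H.mem l ⟨le_rfl, H.le⟩, H.mem r ⟨H.le, le_rfl⟩,
    ⟨T, ⟨hT.verts, hT.isTree⟩, hT.bare_subset⟩, h₁, h₂⟩

end Board

/-! ### Splitting a caterpillar -/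

section Split

variable {n : ℕ} {C : Type*}

theorem Caterpillar.left {V : Type*} {G : SimpleGraph V} {s : Set V} {p : ℕ → V} {h : V → ℕ}
    {l m r : ℕ} (H : Caterpillar G s p h l r) (hl : l ≤ m) (hr : m ≤ r) :
    Caterpillar G {v ∈ s | h v ≤ m} p h l m := by
  have hI : ∀ {i}, i ∈ Set.Icc l m → i ∈ Set.Icc l r := fun hi => ⟨hi.1, hi.2.trans hr⟩
  exact ⟨hl, fun i hi => ⟨H.mem i (hI hi), by rw [H.pos i (hI hi)]; exact hi.2⟩,
    fun i hi => H.pos i (hI hi), fun i hi hi' => H.adj i hi (hi'.trans_le hr),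
    fun v hv => ⟨(H.pos_mem v hv.1).1, hv.2⟩, fun v hv => H.leaf v hv.1⟩

theorem Caterpillar.right {V : Type*} {G : SimpleGraph V} {s : Set V} {p : ℕ → V} {h : V → ℕ}
    {l m r : ℕ} (H : Caterpillar G s p h l r) (hl : l ≤ m) (hr : m < r) :
    Caterpillar G {v ∈ s | m < h v} p h (m + 1) r := by
  have hI : ∀ {i}, i ∈ Set.Icc (m + 1) r → i ∈ Set.Icc l r := fun hi =>
    ⟨by have := hi.1; omega, hi.2⟩
  exact ⟨hr, fun i hi => ⟨H.mem i (hI hi), by rw [H.pos i (hI hi)]; exact hi.1⟩,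
    fun i hi => H.pos i (hI hi), fun i hi hi' => H.adj i (by omega) hi',
    fun v hv => ⟨hv.2, (H.pos_mem v hv.1).2⟩, fun v hv => H.leaf v hv.1⟩

/-! ### Borders separating the two parts of a caterpillar -/

theorem boardGraph_adj {u v : Square n} : (boardGraph n).Adj u v ↔
    (u.1 ≠ v.1 ∧ u.2 = v.2) ∨ (((u.2 : ℕ) + 1 = v.2 ∨ (v.2 : ℕ) + 1 = u.2) ∧ u.1 = v.1) := by
  rw [boardGraph, SimpleGraph.boxProd_adj, SimpleGraph.pathGraph_two_eq_top,
    SimpleGraph.pathGraph_adj, SimpleGraph.top_adj]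

/-- Vertical edges keep the column, so a walk from column at most `j` to a later one uses a
horizontal edge between columns `j` and `j + 1`. -/
theorem exists_crossing {s : Set (Square n)} (hs : ((boardGraph n).induce s).Connected) {j : ℕ}
    {u v : Square n} (hu : u ∈ s) (hv : v ∈ s) (huj : (u.2 : ℕ) ≤ j) (hvj : j < v.2) :
    ∃ x ∈ s, ∃ y ∈ s, x.1 = y.1 ∧ (x.2 : ℕ) = j ∧ (y.2 : ℕ) = j + 1 := by
  by_contra! hne
  have hr := hs.preconnected ⟨u, hu⟩ ⟨v, hv⟩
  rw [SimpleGraph.reachable_iff_reflTransGen] at hr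
  suffices ∀ w : s, Relation.ReflTransGen ((boardGraph n).induce s).Adj ⟨u, hu⟩ w →
      (w.1.2 : ℕ) ≤ j from absurd (this _ hr) (not_le.2 hvj)
  intro w hw
  induction hw with
  | refl => exact huj
  | @tail x y _ hxy ih =>
    by_contra hy
    have hxy' : (boardGraph n).Adj x.1 y.1 := hxy
    rcases boardGraph_adj.1 hxy' with ⟨-, h⟩ | ⟨h, h'⟩
    · rw [← h] at hy
      exact hy ih
    · exact hne x x.2 y y.2 h' (by omega) (by omega)

/-- The border along which a caterpillar is split is monotone in each row. -/
theorem Caterpillar.row_mono {b₁ b₂ : Border n} {p : ℕ → Square n} {h : Square n → ℕ} {l m r : ℕ}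
    (H : Caterpillar (boardGraph n) (between b₁ b₂) p h l r) (hb : b₁ ≤ b₂)
    (h₁ : Incident (p l) b₁) (h₂ : Incident (p r) b₂) (hl : l ≤ m) (hr : m < r)
    {x y : Square n} (hx : x ∈ between b₁ b₂) (hy : y ∈ between b₁ b₂) (hrow : x.1 = y.1)
    (hxy : (x.2 : ℕ) + 1 = y.2) (hxm : m < h x) : m < h y := by
  by_contra hym
  rw [not_lt] at hym
  have hA := (H.left hl hr.le).induce_connected
  have hB := (H.right hl hr).induce_connected
  have hpl : p l ∈ {v ∈ between b₁ b₂ | h v ≤ m} :=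
    (H.left hl hr.le).mem l ⟨le_rfl, hl⟩
  have hpr : p r ∈ {v ∈ between b₁ b₂ | m < h v} :=
    (H.right hl hr).mem r ⟨hr, le_rfl⟩
  have sq_ext : ∀ {u v : Square n}, u.1 = v.1 → (u.2 : ℕ) = v.2 → u = v := fun h h' =>
    Prod.ext h (Fin.ext h')
  -- The left part is connected and contains `y`. If it starts no later than the column of `x`, it
  -- must pass to the next column, and it can do so only in the other row, because `x` belongs to
  -- the right part. The claim `cB` is the mirror image.
  have cA : ((p l).2 : ℕ) ≤ x.2 → ∃ k, k ≠ x.1 ∧ (b₁ k : ℕ) ≤ x.2 ∧ (x.2 : ℕ) + 1 < b₂ k ∧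
      h (k, x.2) ≤ m := by
    intro hlx
    obtain ⟨u, hu, v, hv, huv, hux, hvx⟩ :=
      exists_crossing hA hpl (v := y) ⟨hy, hym⟩ hlx (by omega)
    have e : u = (u.1, x.2) := sq_ext rfl hux
    refine ⟨u.1, fun e' => ?_, hux ▸ hu.1.1, ?_, e ▸ hu.2⟩
    · rw [sq_ext e' hux] at hu
      exact absurd hu.2 (not_le.2 hxm)
    · rw [huv, ← hvx]
      exact hv.1.2
  have cB : (x.2 : ℕ) < (p r).2 → ∃ k, k ≠ x.1 ∧ (b₁ k : ℕ) ≤ x.2 ∧ (x.2 : ℕ) + 1 < b₂ k ∧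
      m < h (k, x.2) := by
    intro hrx
    obtain ⟨u, hu, v, hv, huv, hux, hvx⟩ :=
      exists_crossing hB (u := x) ⟨hx, hxm⟩ hpr le_rfl hrx
    have e : u = (u.1, x.2) := sq_ext rfl hux
    refine ⟨u.1, fun e' => ?_, hux ▸ hu.1.1, ?_, e ▸ hu.2⟩
    · rw [sq_ext (huv.symm.trans (e'.trans hrow)) (by omega : (v.2 : ℕ) = y.2)] at hv
      exact absurd hv.2 (not_lt.2 hym)
    · rw [huv, ← hvx]
      exact hv.1.2
  have hpl' := hpl.1
  have hpr' := hpr.1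
  have hb0 : (b₁ 0 : ℕ) ≤ b₂ 0 := hb 0
  have hb1 : (b₁ 1 : ℕ) ≤ b₂ 1 := hb 1
  generalize p l = u₁ at *
  generalize p r = u₂ at *
  obtain ⟨i₁, j₁⟩ := u₁
  obtain ⟨i₂, j₂⟩ := u₂
  obtain ⟨i, j⟩ := x
  obtain ⟨i', j'⟩ := y
  simp only at hrow
  subst hrow
  simp only [between, Set.mem_ofPred_eq, Incident] at *
  have other : ∀ i k : Fin 2, k ≠ i → k = 1 - i := by decide
  have cA' : (j₁ : ℕ) ≤ j → (b₁ (1 - i) : ℕ) ≤ j ∧ (j : ℕ) + 1 < b₂ (1 - i) ∧ h (1 - i, j) ≤ m := by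
    intro hj
    obtain ⟨k, hk, hk'⟩ := cA hj
    exact other i k hk ▸ hk'
  have cB' : (j : ℕ) < j₂ → (b₁ (1 - i) : ℕ) ≤ j ∧ (j : ℕ) + 1 < b₂ (1 - i) ∧ m < h (1 - i, j) := by
    intro hj
    obtain ⟨k, hk, hk'⟩ := cB hj
    exact other i k hk ▸ hk'
  clear cA cB other hA hB hpl hpr
  generalize h (1 - i, j) = t at *
  -- If both crossings exist, the square beside `x` in the other row lies in both parts. If `j <
  -- j₁`, incidence with `b₁` makes the other row begin after column `j`; if `j₂ ≤ j`, incidence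
  -- with `b₂` makes it end by column `j`. Every combination is contradictory.
  fin_cases i <;> fin_cases i₁ <;> fin_cases i₂ <;> simp at * <;> omega

/-- A horizontal edge across `b` has its common side on `b`; a vertical one lies in a column through
which the horizontal part of `b` runs. -/
theorem incident_of_adj {b₁ b b₂ : Border n} {u v : Square n} (hu : u ∈ between b₁ b)
    (hv : v ∈ between b b₂) (ha : (boardGraph n).Adj u v) : Incident u b ∧ Incident v b := by
  obtain ⟨i, j⟩ := u
  obtain ⟨i', j'⟩ := v
  simp only [between, Set.mem_ofPred_eq] at hu hv
  rcases boardGraph_adj.1 ha with ⟨hne, he⟩ | ⟨he, rfl : i = i'⟩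
  · simp only at hne he
    subst he
    fin_cases i <;> fin_cases i' <;> simp [Incident] at * <;> omega
  · simp only [Incident] at *
    omega

/-- Splitting a caterpillar splits its section along a border. -/
theorem Caterpillar.exists_border {b₁ b₂ : Border n} {p : ℕ → Square n} {h : Square n → ℕ}
    {l m r : ℕ} (H : Caterpillar (boardGraph n) (between b₁ b₂) p h l r) (hb : b₁ ≤ b₂)
    (h₁ : Incident (p l) b₁) (h₂ : Incident (p r) b₂) (hl : l ≤ m) (hr : m < r) :
    ∃ b : Border n, b₁ < b ∧ b < b₂ ∧ between b₁ b = {v ∈ between b₁ b₂ | h v ≤ m} ∧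
      between b b₂ = {v ∈ between b₁ b₂ | m < h v} := by
  have hrow : ∀ i : Fin 2, ∃ t : Fin (n + 1), b₁ i ≤ t ∧ t ≤ b₂ i ∧
      ∀ v ∈ between b₁ b₂, v.1 = i → (h v ≤ m ↔ (v.2 : ℕ) < t) := by
    intro i
    have hbi : (b₁ i : ℕ) ≤ b₂ i := hb i
    -- In each row the border is put before the first square of the right part, or at `b₂ i` if
    -- there is none.
    have hex : ∃ t : ℕ, (b₁ i : ℕ) ≤ t ∧
        (t = b₂ i ∨ ∃ v ∈ between b₁ b₂, v.1 = i ∧ (v.2 : ℕ) = t ∧ m < h v) :=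
      ⟨b₂ i, hb i, Or.inl rfl⟩
    classical
    have hle : Nat.find hex ≤ b₂ i := Nat.find_min' hex ⟨hb i, Or.inl rfl⟩
    obtain ⟨hs₁, hs₂⟩ := Nat.find_spec hex
    refine ⟨⟨Nat.find hex, by have := (b₂ i).2; omega⟩, hs₁, hle, ?_⟩
    intro v hv hvi
    simp only
    constructor
    · intro hvm
      by_contra hlt
      rw [not_lt] at hlt
      have hvb : (v.2 : ℕ) < b₂ i := hvi ▸ hv.2
      rcases hs₂ with hs₂ | ⟨u, hu, hui, hut, hum⟩
      · omega
      · have key : ∀ k, (u.2 : ℕ) ≤ k → ∀ w ∈ between b₁ b₂, w.1 = i → (w.2 : ℕ) = k → m < h w := by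
          intro k hk
          induction k, hk using Nat.le_induction with
          | base =>
            intro w _ hwi hwk
            rwa [show w = u from Prod.ext (hwi.trans hui.symm) (Fin.ext hwk)]
          | succ k hk ih =>
            intro w hw hwi hwk
            have hkn : k < n := by have := w.2.2; omega
            have hw' : (i, (⟨k, hkn⟩ : Fin n)) ∈ between b₁ b₂ := by
              have e₁ : (b₁ i : ℕ) ≤ u.2 := hui ▸ hu.1
              have e₂ : (w.2 : ℕ) < b₂ i := hwi ▸ hw.2
              exact ⟨by simp only; omega, by simp only; omega⟩
            exact H.row_mono hb h₁ h₂ hl hr hw' hw hwi.symm hwk.symm (ih _ hw' rfl rfl)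
        exact absurd hvm (not_le.2 (key v.2 (by omega) v hv hvi rfl))
    · intro hlt
      by_contra hvm
      exact Nat.find_min hex hlt ⟨hvi ▸ hv.1, Or.inr ⟨v, hv, hvi, rfl, not_le.1 hvm⟩⟩
  choose b hb₁ hb₂ hbm using hrow
  have e₁ : between b₁ b = {v ∈ between b₁ b₂ | h v ≤ m} := by
    ext v
    constructor
    · rintro ⟨hv, hv'⟩
      have hm : v ∈ between b₁ b₂ := ⟨hv, hv'.trans_le (hb₂ v.1)⟩
      exact ⟨hm, (hbm v.1 v hm rfl).2 hv'⟩
    · rintro ⟨hv, hvm⟩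
      exact ⟨hv.1, (hbm v.1 v hv rfl).1 hvm⟩
  have e₂ : between b b₂ = {v ∈ between b₁ b₂ | m < h v} := by
    ext v
    constructor
    · rintro ⟨hv, hv'⟩
      have hm : v ∈ between b₁ b₂ := ⟨(show (b₁ v.1 : ℕ) ≤ b v.1 from hb₁ v.1).trans hv, hv'⟩
      exact ⟨hm, not_le.1 fun hle => absurd ((hbm v.1 v hm rfl).1 hle) (not_lt.2 hv)⟩
    · rintro ⟨hv, hvm⟩
      exact ⟨not_lt.1 fun hlt => absurd ((hbm v.1 v hv rfl).2 hlt) (not_le.2 hvm), hv.2⟩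
  have hempty : ∀ b : Border n, between b b = ∅ := fun b =>
    Set.eq_empty_of_forall_notMem fun v hv => absurd hv.2 (not_lt.2 hv.1)
  -- The inequalities are strict because each part contains an end of the path.
  refine ⟨b, lt_of_le_of_ne hb₁ ?_, lt_of_le_of_ne hb₂ ?_, e₁, e₂⟩
  · rintro rfl
    have := (H.left hl hr.le).mem l ⟨le_rfl, hl⟩
    rw [← e₁, hempty] at this
    exact this
  · rintro rfl
    have := (H.right hl hr).mem r ⟨hr, le_rfl⟩
    rw [← e₂, hempty] at this
    exact this

end Split

/-! ### Correctness of the dynamic program -/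

section Correctness

variable {n : ℕ} {C : Type*}

theorem LineAchieves.congr {c c' : ℕ → C} {R R' : ℕ → Set C} {l r : ℕ} {d : C} {I : Set C}
    {S : List (ℕ × C)} (h : LineAchieves c R l r d I S) (hc : Set.EqOn c' c (Set.Icc l r))
    (hR : ∀ i ∈ Set.Icc l r, R' i ⊆ R i) : LineAchieves c' R' l r d I S := by
  obtain ⟨h₁, h₂⟩ := linePlay_congr hc S h.mem
  refine ⟨h.mem, fun i hi => by rw [h₁ hi]; exact h.flood i hi, fun i hi x hx hxI => ?_⟩
  rw [h₂ i hi]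
  exact h.hist i hi x (hR i hi hx) hxI

/-! ### Soundness of the recursion: `f ≤ f*` -/

open Classical in
theorem Caterpillar.join {V : Type*} {G : SimpleGraph V} {s₁ s₂ : Set V} {p₁ p₂ : ℕ → V}
    {h₁ h₂ : V → ℕ} {l m r : ℕ} (H₁ : Caterpillar G s₁ p₁ h₁ l m)
    (H₂ : Caterpillar G s₂ p₂ h₂ (m + 1) r) (hd : Disjoint s₁ s₂)
    (ha : G.Adj (p₁ m) (p₂ (m + 1))) :
    Caterpillar G (s₁ ∪ s₂) (fun i => if i ≤ m then p₁ i else p₂ i)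
      (fun v => if v ∈ s₁ then h₁ v else h₂ v) l r := by
  have hle₁ := H₁.le
  have hle₂ := H₂.le
  have hp₁ : ∀ v ∈ s₁, h₁ v ≤ m := fun v hv => (H₁.pos_mem v hv).2
  have hp₂ : ∀ v ∈ s₂, ¬ h₂ v ≤ m := fun v hv => by have := (H₂.pos_mem v hv).1; omega
  have hn : ∀ v ∈ s₂, v ∉ s₁ := fun v hv hv' => Set.disjoint_left.1 hd hv' hv
  refine ⟨by omega, fun i hi => ?_, fun i hi => ?_, fun i hi hi' => ?_, fun v hv => ?_,
    fun v hv hne => ?_⟩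
  · by_cases him : i ≤ m
    · simp only [him, if_true]
      exact Or.inl (H₁.mem i ⟨hi.1, him⟩)
    · simp only [him, if_false]
      exact Or.inr (H₂.mem i ⟨by omega, hi.2⟩)
  · by_cases him : i ≤ m
    · simp only [him, if_true, H₁.mem i ⟨hi.1, him⟩]
      exact H₁.pos i ⟨hi.1, him⟩
    · have hi₂ : i ∈ Set.Icc (m + 1) r := ⟨by omega, hi.2⟩
      simp only [him, if_false, hn _ (H₂.mem i hi₂)]
      exact H₂.pos i hi₂
  · rcases lt_trichotomy i m with him | rfl | him
    · simp only [him.le, Nat.succ_le_iff.2 him, if_true]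
      exact H₁.adj i hi him
    · simp only [le_refl, if_true, show ¬ i + 1 ≤ i by omega, if_false]
      exact ha
    · simp only [show ¬ i ≤ m by omega, show ¬ i + 1 ≤ m by omega, if_false]
      exact H₂.adj i him hi'
  · rcases hv with hv | hv
    · simp only [hv, if_true]
      have := H₁.pos_mem v hv
      exact ⟨this.1, by have := this.2; omega⟩
    · simp only [hn v hv, if_false]
      have := H₂.pos_mem v hv
      exact ⟨by have := this.1; omega, this.2⟩
  · rcases hv with hv | hv
    · simp only [hv, if_true, hp₁ v hv] at hne ⊢
      exact H₁.leaf v hv hne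
    · simp only [hn v hv, if_false, hp₂ v hv] at hne ⊢
      exact H₂.leaf v hv hne

/-- Anchor each vertex off the path at any adjacent path vertex; the empty sequence works, as `d` is
in every history from the start. -/
theorem f_eq_zero_of_initZero {ω : Square n → C} {z : Param n C} (h0 : InitZero ω z) :
    f ω z = 0 := by
  obtain ⟨q, hq, hqd, hrest⟩ := h0
  have hpos : ∀ v, ∃ k, k ≤ q.length ∧ (v ∈ q.support → q.getVert k = v) ∧
      (v ∈ between z.b₁ z.b₂ → v ∉ q.support → (boardGraph n).Adj v (q.getVert k)) := by
    intro v
    by_cases hv : v ∈ q.support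
    · obtain ⟨k, hk, hkl⟩ := SimpleGraph.Walk.mem_support_iff_exists_getVert.1 hv
      exact ⟨k, hkl, fun _ => hk, fun _ h => absurd hv h⟩
    · by_cases hvs : v ∈ between z.b₁ z.b₂
      · obtain ⟨⟨u, hu, huv⟩, -⟩ := hrest v hvs hv
        obtain ⟨k, rfl, hkl⟩ := SimpleGraph.Walk.mem_support_iff_exists_getVert.1 hu
        exact ⟨k, hkl, fun h => absurd h hv, fun _ _ => huv⟩
      · exact ⟨0, Nat.zero_le _, fun h => absurd h hv, fun h => absurd h hvs⟩
  choose k hkl hk hk' using hpos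
  have hoff : ∀ v, v ≠ q.getVert (k v) → v ∉ q.support := fun v hne hv => hne (hk v hv).symm
  have H : Caterpillar (boardGraph n) (between z.b₁ z.b₂) q.getVert k 0 q.length :=
    ⟨Nat.zero_le _, fun i _ => (hqd _ (q.getVert_mem_support i)).1,
      fun i hi => hq.getVert_injOn (hkl _) hi.2 (hk _ (q.getVert_mem_support i)),
      fun i _ hi => q.adj_getVert_succ hi, fun v _ => ⟨Nat.zero_le _, hkl v⟩,
      fun v hv hne => hk' v hv (hoff v hne)⟩
  have hS : LineAchieves (ω ∘ q.getVert) (leafColours ω (between z.b₁ z.b₂) q.getVert k) 0 q.length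
      z.d z.I [] := by
    refine ⟨by simp, fun i _ => (hqd _ (q.getVert_mem_support i)).2, ?_⟩
    rintro i - x ⟨v, hv, rfl, hne, rfl⟩ hvI
    have := (hrest v hv (hoff v hne)).2.resolve_left hvI
    rw [lineHist_nil, Function.comp_apply, (hqd _ (q.getVert_mem_support _)).2]
    exact this
  simpa using H.f_le (by simp) (by simp) hS

theorem f_le_f₁ {ω : Square n → C} {z : Param n C} (hz : z ∈ Z n C) : f ω z ≤ f₁ (f ω) z := by
  have : Nonempty C := ⟨z.d⟩
  obtain ⟨d', hd'⟩ := ciInf_mem fun d' : C => f ω ⟨z.b₁, z.b₂, z.r₁, z.r₂, d', z.I ∪ {z.d}⟩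
  rw [f₁, ← hd']
  by_cases ht : f ω ⟨z.b₁, z.b₂, z.r₁, z.r₂, d', z.I ∪ {z.d}⟩ = ⊤
  · simp only [ht, add_top, le_top]
  have hz' : (⟨z.b₁, z.b₂, z.r₁, z.r₂, d', z.I ∪ {z.d}⟩ : Param n C) ∈ Z n C := hz
  obtain ⟨p, h, r, S, H, h₁, h₂, hS, hlen⟩ := exists_of_f_ne_top hz' ht 0
  refine (H.f_le (z := z) h₁ h₂ (hS.concat H.le)).trans ?_
  simp only [hlen, List.length_append, List.length_singleton, Nat.cast_add, Nat.cast_one]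
  rw [add_comm]

theorem between_union {b₁ b b₂ : Border n} (h₁ : b₁ ≤ b) (h₂ : b ≤ b₂) :
    between b₁ b ∪ between b b₂ = between b₁ b₂ := by
  ext v
  have h₁' : (b₁ v.1 : ℕ) ≤ b v.1 := h₁ v.1
  have h₂' : (b v.1 : ℕ) ≤ b₂ v.1 := h₂ v.1
  simp only [between, Set.mem_union, Set.mem_ofPred_eq]
  omega

theorem disjoint_between {b₁ b b₂ : Border n} : Disjoint (between b₁ b) (between b b₂) :=
  Set.disjoint_left.2 fun _ h₁ h₂ => absurd h₂.1 (not_le.2 h₁.2)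

/-- Optimal caterpillars of the two sections are joined along the edge `x₁x₂`. Their sequences
cannot simply be played one after the other, which is why `LineCost.append` is needed. -/
theorem f_le_f₂ (ω : Square n → C) (z : Param n C) : f ω z ≤ f₂ (f ω) z := by
  classical
  unfold f₂
  refine le_iInf fun b => le_iInf fun x₁ => le_iInf fun x₂ => le_iInf fun hs => ?_
  obtain ⟨hz₁, hz₂, hb₁, hb₂, ha⟩ := hs
  by_cases ht₁ : f ω ⟨z.b₁, b, z.r₁, x₁, z.d, z.I⟩ = ⊤
  · simp [ht₁]
  by_cases ht₂ : f ω ⟨b, z.b₂, x₂, z.r₂, z.d, z.I⟩ = ⊤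
  · simp [ht₂]
  obtain ⟨p₁, h₁, m, S₁, H₁, hl₁, hm₁, hS₁, hlen₁⟩ := exists_of_f_ne_top hz₁ ht₁ 0
  obtain ⟨p₂, h₂, r, S₂, H₂, hm₂, hr₂, hS₂, hlen₂⟩ := exists_of_f_ne_top hz₂ ht₂ (m + 1)
  dsimp only at *
  have hd : Disjoint (between z.b₁ b) (between b z.b₂) := disjoint_between
  have H := H₁.join H₂ hd (by rwa [hm₁, hm₂])
  have hle := H₂.le
  rw [between_union hb₁.le hb₂.le] at H
  have hR : ∀ i v, v ∈ between z.b₁ z.b₂ →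
      (if v ∈ between z.b₁ b then h₁ v else h₂ v) = i →
      (v ∈ between z.b₁ b ∧ h₁ v = i ∧ i ≤ m) ∨ (v ∈ between b z.b₂ ∧ h₂ v = i ∧ m < i) := by
    intro i v hv hi
    rw [← between_union hb₁.le hb₂.le] at hv
    rcases hv with hv | hv
    · rw [if_pos hv] at hi
      exact Or.inl ⟨hv, hi, hi ▸ (H₁.pos_mem v hv).2⟩
    · rw [if_neg fun hv' => Set.disjoint_left.1 hd hv' hv] at hi
      exact Or.inr ⟨hv, hi, hi ▸ (H₂.pos_mem v hv).1⟩
  have hA := hS₁.congr (c' := ω ∘ fun i => if i ≤ m then p₁ i else p₂ i)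
    (R' := leafColours ω (between z.b₁ z.b₂) (fun i => if i ≤ m then p₁ i else p₂ i)
      (fun v => if v ∈ between z.b₁ b then h₁ v else h₂ v))
    (fun i hi => by simp [hi.2]) (by
      rintro i hi x ⟨v, hv, he, hne, rfl⟩
      rcases hR i v hv he with ⟨hv, he, him⟩ | ⟨hv, he, him⟩
      · simp only [him, if_true] at hne
        exact ⟨v, hv, he, hne, rfl⟩
      · exact absurd hi.2 (not_le.2 him))
  have hB := hS₂.congr (c' := ω ∘ fun i => if i ≤ m then p₁ i else p₂ i)
    (R' := leafColours ω (between z.b₁ z.b₂) (fun i => if i ≤ m then p₁ i else p₂ i)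
      (fun v => if v ∈ between z.b₁ b then h₁ v else h₂ v))
    (fun i hi => by simp [not_le.2 (Nat.lt_of_succ_le hi.1)]) (by
      rintro i hi x ⟨v, hv, he, hne, rfl⟩
      rcases hR i v hv he with ⟨hv, he, him⟩ | ⟨hv, he, him⟩
      · exact absurd him (not_le.2 hi.1)
      · simp only [not_le.2 him, if_false] at hne
        exact ⟨v, hv, he, hne, rfl⟩)
  obtain ⟨S, hS, hlen⟩ := LineCost.append _ H₁.le (Nat.lt_of_succ_le hle) ⟨S₁, hA, le_rfl⟩
    ⟨S₂, hB, le_rfl⟩ rfl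
  refine (H.f_le ?_ ?_ hS).trans ?_
  · simpa using hl₁
  · simp only [show ¬ r ≤ m by omega, if_false]
    exact hr₂
  · rw [hlen₁, hlen₂]
    exact_mod_cast hlen

theorem f_le_table (ω : Square n → C) (k : ℕ) : ∀ z ∈ Z n C, f ω z ≤ table ω k z := by
  induction k with
  | zero =>
    intro z _
    by_cases h0 : InitZero ω z
    · simp [f_eq_zero_of_initZero h0]
    · simp [table, h0]
  | succ k ih =>
    intro z hz
    by_cases h0 : InitZero ω z
    · simp [f_eq_zero_of_initZero h0]
    simp only [table, step, h0, if_false, le_min_iff]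
    constructor
    · refine (f_le_f₁ hz).trans ?_
      unfold f₁
      exact add_le_add le_rfl (iInf_mono fun d' => ih _ hz)
    · refine (f_le_f₂ ω z).trans ?_
      unfold f₂
      exact iInf_mono fun b => iInf_mono fun x₁ => iInf_mono fun x₂ => iInf_mono fun hs =>
        add_le_add (ih _ hs.1) (ih _ hs.2.1)

theorem f_le_fStar (ω : Square n → C) {z : Param n C} (hz : z ∈ Z n C) : f ω z ≤ fStar ω z :=
  le_iInf fun k => f_le_table ω k z hz

/-! ### Completeness of the recursion: `f* ≤ f` -/

theorem fStar_le_f₁ (ω : Square n → C) (z : Param n C) : fStar ω z ≤ f₁ (fStar ω) z := by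
  rw [fStar_eq_step, step]
  split_ifs
  · exact zero_le
  · exact min_le_left _ _

theorem fStar_le_f₂ (ω : Square n → C) (z : Param n C) : fStar ω z ≤ f₂ (fStar ω) z := by
  rw [fStar_eq_step, step]
  split_ifs
  · exact zero_le
  · exact min_le_right _ _

/-- Splitting shortens the path without adding moves, and dropping the last move keeps the path, so
path length plus number of moves decreases. The maps `p` and `h` stay fixed, since the parts of a
caterpillar are restrictions of it. -/
theorem fStar_le_length (ω : Square n → C) {p : ℕ → Square n} {h : Square n → ℕ} (N : ℕ) :
    ∀ {b₁ b₂ : Border n} {l r : ℕ} {d : C} {I : Set C} {S : List (ℕ × C)},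
      r - l + S.length = N → b₁ < b₂ → Caterpillar (boardGraph n) (between b₁ b₂) p h l r →
      Incident (p l) b₁ → Incident (p r) b₂ →
      LineAchieves (ω ∘ p) (leafColours ω (between b₁ b₂) p h) l r d I S →
      fStar ω ⟨b₁, b₂, p l, p r, d, I⟩ ≤ S.length := by
  induction N using Nat.strong_induction_on with
  | _ N ih =>
  intro b₁ b₂ l r d I S hN hb H h₁ h₂ hS
  by_cases hex : ∃ j, l ≤ j ∧ j < r ∧ ¬ Crossed (ω ∘ p) S j
  · obtain ⟨j, hl, hr, hj⟩ := hex
    obtain ⟨S₁, S₂, hS₁, hS₂, hlen, -⟩ := hS.split hl hr hj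
    obtain ⟨b, hb₁, hb₂, e₁, e₂⟩ := H.exists_border hb.le h₁ h₂ hl hr
    have H₁ := H.left hl hr.le
    have H₂ := H.right hl hr
    rw [← e₁] at H₁
    rw [← e₂] at H₂
    have hadj := H.adj j hl hr
    obtain ⟨hi₁, hi₂⟩ := incident_of_adj (H₁.mem j ⟨hl, le_rfl⟩) (H₂.mem (j + 1) ⟨le_rfl, hr⟩) hadj
    refine (fStar_le_f₂ ω _).trans ((f₂_le _ (b := b) (x₁ := p j) (x₂ := p (j + 1))
      ⟨H₁.mem_Z hb₁ h₁ hi₁ d I, H₂.mem_Z hb₂ hi₂ h₂ d I, hb₁, hb₂, hadj⟩).trans ?_)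
    rw [← hlen, Nat.cast_add]
    refine add_le_add (ih _ (by omega) rfl hb₁ H₁ h₁ hi₁ (hS₁.congr (Set.eqOn_refl _ _) ?_))
      (ih _ (by omega) rfl hb₂ H₂ hi₂ h₂ (hS₂.congr (Set.eqOn_refl _ _) ?_))
    · rintro i - x ⟨v, hv, hv'⟩
      rw [e₁] at hv
      exact ⟨v, hv.1, hv'⟩
    · rintro i - x ⟨v, hv, hv'⟩
      rw [e₂] at hv
      exact ⟨v, hv.1, hv'⟩
  · push Not at hex
    rcases hS.atom H.le hex with ⟨rfl, hc, hR, rfl⟩ | ⟨d', S', hS', hlen⟩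
    · have h0 : InitZero ω (⟨b₁, b₂, p l, p l, d, I⟩ : Param n C) := by
        refine ⟨.nil, .nil, ?_, fun v hv hvp => ?_⟩
        · intro v hv
          rw [SimpleGraph.Walk.support_nil, List.mem_singleton] at hv
          subst hv
          exact ⟨H.mem l ⟨le_rfl, le_rfl⟩, hc⟩
        · rw [SimpleGraph.Walk.support_nil, List.mem_singleton] at hvp
          have hvl : h v = l := le_antisymm (H.pos_mem v hv).2 (H.pos_mem v hv).1
          have := H.leaf v hv (by rwa [hvl])
          rw [hvl] at this
          exact ⟨⟨p l, by simp, this⟩, hR ⟨v, hv, hvl, hvp, rfl⟩⟩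
      rw [fStar_eq_step, step, if_pos h0]
      exact zero_le
    · refine (fStar_le_f₁ ω _).trans ?_
      rw [f₁, ← hlen, Nat.cast_add, Nat.cast_one, add_comm]
      exact add_le_add ((iInf_le _ d').trans (ih _ (by omega) rfl hb H h₁ h₂ hS')) le_rfl

theorem fStar_le_f {ω : Square n → C} {z : Param n C} (hz : z ∈ Z n C) : fStar ω z ≤ f ω z := by
  by_cases ht : f ω z = ⊤
  · simp [ht]
  obtain ⟨p, h, r, S, H, h₁, h₂, hS, hlen⟩ := exists_of_f_ne_top hz ht 0
  have hi₁ := hz.2.2.2.2.1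
  have hi₂ := hz.2.2.2.2.2
  rw [← h₁] at hi₁
  rw [← h₂] at hi₂
  have := fStar_le_length ω _ rfl hz.1.1 H hi₁ hi₂ hS
  rw [h₁, h₂] at this
  rw [hlen]
  exact this

end Correctness

end FloodIt

theorem mainTheorem4 {n : ℕ} {C : Type*} [Finite C] (ω : FloodIt.Square n → C) :
    ∀ z ∈ FloodIt.Z n C, FloodIt.f ω z ≠ ⊤ ∧ FloodIt.fStar ω z = FloodIt.f ω z :=
  fun _ hz => ⟨FloodIt.f_ne_top ω hz,
    le_antisymm (FloodIt.fStar_le_f hz) (FloodIt.f_le_fStar ω hz)⟩
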